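/- All algebras are associative, possibly non-unital, over $\mathbb{C}$, with non-degenerate product ($ab=0$ for all $b$, or $ba=0$ for all $b$, implies $a=0$). For such an algebra $B$, $M(B)$ denotes the multiplier algebra: pairs $m=(l,r)$ of linear maps, written $mb=l(b)$, $bm=r(b)$, with $m(bb')=(mb)b'$, $(bb')m=b(b'm)$, $(bm)b'=b(mb')$; $B$ embeds in $M(B)$. Let $(A,\Delta)$ be a regular weak multiplier Hopf algebra in the sense of Van Daele and Wang: $A$ is idempotent ($A^2=A$), $\Delta:A\to M(A\otimes A)$ is a full coproduct with counit $\varepsilon$; with $T_1(a\otimes b)=\Delta(a)(1\otimes b)$ and $T_2(a\otimes b)=(a\otimes 1)\Delta(b)$ (maps from $A\otimes A$ to itself) there is an idempotent $E\in M(A\otimes A)$ with $E(A\otimes A)=T_1(A\otimes A)$, $(A\otimes A)E=T_2(A\otimes A)$ and $(\iota\otimes\Delta)E=(E\otimes1)(1\otimes E)=(1\otimes E)(E\otimes1)$; $\ker T_i=(1-G_i)(A\otimes A)$, where $G_1,G_2$ are the linear maps on $A\otimes A$ given by $(G_1\otimes\iota)(\Delta_{13}(a)(1\otimes b\otimes c))=\Delta_{13}(a)(1\otimes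 E)(1\otimes b\otimes c)$ and $(\iota\otimes G_2)((a\otimes b\otimes 1)\Delta_{13}(c))=(a\otimes b\otimes1)(E\otimes1)\Delta_{13}(c)$; and, for regularity, $\Delta(a)(b\otimes1),(1\otimes a)\Delta(b)\in A\otimes A$ for all $a,b\in A$, and $(A,\Delta^{\rm cop})$ satisfies the same axioms. Let $R$ be a left $A$-module algebra: an algebra with a left $A$-module structure that is unital ($AR=R$) and satisfies $a(xy)=\sum(a_{(1)}x)(a_{(2)}y)$, i.e. $a(xy)=\mu(\Delta(a)(x\otimes y))$ with $\mu$ the product of $R$ and $\Delta(a)((bx)\otimes(cy))=(\Delta(a)(b\otimes c))(x\otimes y)$. Then $A$ has a bijective antipode $S:A\to A$, that is, a bijective linear map such that $R_1(a\otimes b)=\sum a_{(1)}\otimes S(a_{(2)})b$ and $R_2(a\otimes b)=\sum aS(b_{(1)})\otimes b_{(2)}$ are well-defined linear maps on $A\otimes A$ with $T_1R_1=E\,\cdot\,$, $R_1T_1=G_1$, $R_1T_1R_1=R_1$ and $T_2R_2=\,\cdot\,E$, $R_2T_2=G_2$, $R_2T_2R_2=R_2$. Moreover there is a target map $\varepsilon_t:A\to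 M(A)$, $\varepsilon_t(a)b=(\varepsilon\otimes\iota)(E(a\otimes b))$, and the $A$-module $R$ extends to a unital $M(A)$-module. Finally, there is a left $A$-module structure on $M(R)$, $(a,m)\mapsto am$, such that for all $a\in A$, $m\in M(R)$, $r\in R$: 1. it extends the action on $R\subseteq M(R)$; 2. $(am)r=\sum a_{(1)}\bigl(m(S(a_{(2)})r)\bigr)$ and $r(am)=\sum a_{(2)}\bigl((S^{-1}(a_{(1)})r)m\bigr)$, that is, for $c\in A$ and $x\in R$: $(am)(S(c)x)=\sum p\bigl(m(S(q)x)\bigr)$ where $\sum p\otimes q=(1\otimes c)\Delta(a)$, and $(S^{-1}(c)x)(am)=\sum q\bigl((S^{-1}(p)x)m\bigr)$ where $\sum p\otimes q=(c\otimes1)\Delta(a)$; 3. $a1=\varepsilon_t(a)$, i.e. $(a1)r=\varepsilon_t(a)r$ in the extended $M(A)$-module $R$; 4. it is non-degenerate: if $am=0$ for all $a\in A$, then $m=0$. -/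

import Mathlib

open scoped TensorProduct

noncomputable section

/-! ### Algebras without unit and their multiplier algebras -/

section Multipliers

variable (A : Type*) [NonUnitalRing A] [Module ℂ A] [IsScalarTower ℂ A A] [SMulCommClass ℂ A A]

/-- The product of `A` is non-degenerate (on both sides). -/
def NondegenerateProduct : Prop :=
  (∀ a : A, (∀ b : A, a * b = 0) → a = 0) ∧ (∀ a : A, (∀ b : A, b * a = 0) → a = 0)

/-- `A² = A`, where `A²` is the linear span of all products. -/
def IdempotentAlgebra : Prop :=
  Submodule.span ℂ (Set.range fun p : A × A => p.1 * p.2) = ⊤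

/-- The multiplier algebra `M(A)`: pairs `(l, r)` of a left multiplier `l` (acting as `a ↦ m a`)
and a right multiplier `r` (acting as `a ↦ a m`) with `r(a) b = a l(b)`. The product is
`(l, r) (l', r') = (l ∘ l', r' ∘ r)`, which is why the second factor is an opposite algebra. -/
def multiplierSubalgebra : Subalgebra ℂ (Module.End ℂ A × (Module.End ℂ A)ᵐᵒᵖ) where
  carrier := {m | (∀ a b, m.1 (a * b) = m.1 a * b) ∧
    (∀ a b, m.2.unop (a * b) = a * m.2.unop b) ∧
    (∀ a b, m.2.unop a * b = a * m.1 b)}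
  mul_mem' := by
    rintro x y ⟨hx1, hx2, hx3⟩ ⟨hy1, hy2, hy3⟩
    refine ⟨fun a b => ?_, fun a b => ?_, fun a b => ?_⟩
    · simp [hx1, hy1]
    · simp [hx2, hy2]
    · simp [hx3, hy3]
  add_mem' := by
    rintro x y ⟨hx1, hx2, hx3⟩ ⟨hy1, hy2, hy3⟩
    refine ⟨fun a b => ?_, fun a b => ?_, fun a b => ?_⟩
    · simp [hx1, hy1, add_mul]
    · simp [hx2, hy2, mul_add]
    · simp [hx3, hy3, mul_add, add_mul]
  algebraMap_mem' := by
    intro c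
    refine ⟨fun a b => ?_, fun a b => ?_, fun a b => ?_⟩ <;>
      simp [Algebra.algebraMap_eq_smul_one, smul_mul_assoc, mul_smul_comm]

/-- The multiplier algebra `M(A)`. -/
def MultAlg : Type _ := multiplierSubalgebra A

instance : Ring (MultAlg A) := inferInstanceAs (Ring (multiplierSubalgebra A))

instance : Algebra ℂ (MultAlg A) := inferInstanceAs (Algebra ℂ (multiplierSubalgebra A))

end Multipliers

namespace MultAlg

variable {A : Type*} [NonUnitalRing A] [Module ℂ A] [IsScalarTower ℂ A A] [SMulCommClass ℂ A A]
variable {B : Type*} [NonUnitalRing B] [Module ℂ B] [IsScalarTower ℂ B B] [SMulCommClass ℂ B B]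

/-- `m.l a` is the product `m a`. -/
def l (m : MultAlg A) : A →ₗ[ℂ] A := m.1.1

/-- `m.r a` is the product `a m`. -/
def r (m : MultAlg A) : A →ₗ[ℂ] A := m.1.2.unop

theorem l_mul (m : MultAlg A) (a b : A) : m.l (a * b) = m.l a * b := m.2.1 a b

theorem r_mul (m : MultAlg A) (a b : A) : m.r (a * b) = a * m.r b := m.2.2.1 a b

theorem r_mul_eq (m : MultAlg A) (a b : A) : m.r a * b = a * m.l b := m.2.2.2 a b

/-- Build a multiplier from its left and right parts. -/
def mk (f g : A →ₗ[ℂ] A) (h₁ : ∀ a b, f (a * b) = f a * b) (h₂ : ∀ a b, g (a * b) = a * g b)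
    (h₃ : ∀ a b, g a * b = a * f b) : MultAlg A :=
  ⟨(f, MulOpposite.op g), h₁, h₂, h₃⟩

/-- The canonical map `A → M(A)`; it sends `a` to left and right multiplication by `a`. -/
def incl (a : A) : MultAlg A :=
  mk (LinearMap.mulLeft ℂ a) (LinearMap.mulRight ℂ a)
    (fun b c => by simp [mul_assoc]) (fun b c => by simp [mul_assoc])
    (fun b c => by simp [mul_assoc])

/-- The embedding `M(A) ⊗ M(B) → M(A ⊗ B)` on elementary tensors. -/
def tmul (m : MultAlg A) (n : MultAlg B) : MultAlg (A ⊗[ℂ] B) :=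
  mk (TensorProduct.map m.l n.l) (TensorProduct.map m.r n.r)
    (fun x y => by
      induction x with
      | zero => simp
      | add x x' hx hx' => simp [add_mul, hx, hx']
      | tmul a b =>
        induction y with
        | zero => simp
        | add y y' hy hy' => simp only [mul_add, map_add, hy, hy']
        | tmul a' b' => simp [l_mul])
    (fun x y => by
      induction x with
      | zero => simp
      | add x x' hx hx' => simp [add_mul, hx, hx']
      | tmul a b =>
        induction y with
        | zero => simp
        | add y y' hy hy' => simp only [mul_add, map_add, hy, hy']
        | tmul a' b' => simp [r_mul])
    (fun x y => by
      induction x with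
      | zero => simp
      | add x x' hx hx' => simp [add_mul, hx, hx']
      | tmul a b =>
        induction y with
        | zero => simp
        | add y y' hy hy' => simp only [mul_add, map_add, hy, hy']
        | tmul a' b' => simp [r_mul_eq])

/-- Transport of multipliers along a multiplicative linear isomorphism. -/
def transport (e : A ≃ₗ[ℂ] B) (he : ∀ x y, e (x * y) = e x * e y) (m : MultAlg A) : MultAlg B :=
  have he' : ∀ x y, e.symm (x * y) = e.symm x * e.symm y := fun x y => by
    apply e.injective; simp [he]
  mk (e.toLinearMap ∘ₗ m.l ∘ₗ e.symm.toLinearMap) (e.toLinearMap ∘ₗ m.r ∘ₗ e.symm.toLinearMap)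
    (fun x y => by simp [he, he', l_mul]) (fun x y => by simp [he, he', r_mul])
    (fun x y => by
      have h := congrArg e (m.r_mul_eq (e.symm x) (e.symm y))
      simpa [he] using h)

variable (A) in
theorem assoc_mul (x y : (A ⊗[ℂ] A) ⊗[ℂ] A) :
    TensorProduct.assoc ℂ A A A (x * y) =
      TensorProduct.assoc ℂ A A A x * TensorProduct.assoc ℂ A A A y := by
  induction x with
  | zero => simp
  | add x x' hx hx' => simp [add_mul, hx, hx']
  | tmul u c =>
    induction u with
    | zero => simp
    | add u u' hu hu' => simp only [TensorProduct.add_tmul, add_mul, map_add, hu, hu']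
    | tmul a b =>
      induction y with
      | zero => simp
      | add y y' hy hy' => simp only [mul_add, map_add, hy, hy']
      | tmul v c' =>
        induction v with
        | zero => simp
        | add v v' hv hv' => simp only [TensorProduct.add_tmul, mul_add, map_add, hv, hv']
        | tmul a' b' => simp

/-- For `E ∈ M(A ⊗ A)`, the multiplier `E ⊗ 1` of `A ⊗ A ⊗ A`. -/
def leg₁₂ (E : MultAlg (A ⊗[ℂ] A)) : MultAlg (A ⊗[ℂ] (A ⊗[ℂ] A)) :=
  transport (TensorProduct.assoc ℂ A A A) (assoc_mul A) (tmul E (1 : MultAlg A))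

/-- For `E ∈ M(A ⊗ A)`, the multiplier `1 ⊗ E` of `A ⊗ A ⊗ A`. -/
def leg₂₃ (E : MultAlg (A ⊗[ℂ] A)) : MultAlg (A ⊗[ℂ] (A ⊗[ℂ] A)) :=
  tmul (1 : MultAlg A) E

end MultAlg

open MultAlg

/-! ### Weak multiplier Hopf algebras -/

section Legs

variable {A : Type*} [AddCommGroup A] [Module ℂ A]

/-- `(ω ⊗ ι) : A ⊗ A → A` for a linear functional `ω`. -/
def sliceLeft (ω : A →ₗ[ℂ] ℂ) : A ⊗[ℂ] A →ₗ[ℂ] A :=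
  (TensorProduct.lid ℂ A).toLinearMap ∘ₗ TensorProduct.map ω LinearMap.id

/-- `(ι ⊗ ω) : A ⊗ A → A` for a linear functional `ω`. -/
def sliceRight (ω : A →ₗ[ℂ] ℂ) : A ⊗[ℂ] A →ₗ[ℂ] A :=
  (TensorProduct.rid ℂ A).toLinearMap ∘ₗ TensorProduct.map LinearMap.id ω

/-- With `T(a ⊗ c) = Δ(a)(1 ⊗ c)`, this is
`a ⊗ (b ⊗ c) ↦ Δ₁₃(a)(1 ⊗ b ⊗ c) = ∑ (a₍₁₎ ⊗ b) ⊗ a₍₂₎c`. -/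
def delta₁₃Right (T : A ⊗[ℂ] A →ₗ[ℂ] A ⊗[ℂ] A) :
    A ⊗[ℂ] (A ⊗[ℂ] A) →ₗ[ℂ] (A ⊗[ℂ] A) ⊗[ℂ] A :=
  (TensorProduct.assoc ℂ A A A).symm.toLinearMap ∘ₗ
    (TensorProduct.leftComm ℂ A A A).toLinearMap ∘ₗ
      TensorProduct.map LinearMap.id T ∘ₗ (TensorProduct.leftComm ℂ A A A).toLinearMap

/-- With `T(a ⊗ c) = (a ⊗ 1)Δ(c)`, this is
`(a ⊗ b) ⊗ c ↦ (a ⊗ b ⊗ 1)Δ₁₃(c) = ∑ a c₍₁₎ ⊗ (b ⊗ c₍₂₎)`. -/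
def delta₁₃Left (T : A ⊗[ℂ] A →ₗ[ℂ] A ⊗[ℂ] A) :
    (A ⊗[ℂ] A) ⊗[ℂ] A →ₗ[ℂ] A ⊗[ℂ] (A ⊗[ℂ] A) :=
  (TensorProduct.assoc ℂ A A A).toLinearMap ∘ₗ
    (TensorProduct.rightComm ℂ A A A).toLinearMap ∘ₗ
      TensorProduct.map T LinearMap.id ∘ₗ (TensorProduct.rightComm ℂ A A A).toLinearMap

end Legs

/-- A coproduct `Δ : A → M(A ⊗ A)`. The canonical maps `T₁`, `T₂` are determined by `Δ` when the
product of `A` is non-degenerate; carrying them expresses that `Δ(a)(1 ⊗ b)` and `(a ⊗ 1)Δ(b)`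
lie in `A ⊗ A`. -/
structure Coproduct (A : Type*) [NonUnitalRing A] [Module ℂ A] [IsScalarTower ℂ A A]
    [SMulCommClass ℂ A A] where
  Δ : A →ₙₐ[ℂ] MultAlg (A ⊗[ℂ] A)
  T₁ : A ⊗[ℂ] A →ₗ[ℂ] A ⊗[ℂ] A
  T₂ : A ⊗[ℂ] A →ₗ[ℂ] A ⊗[ℂ] A
  /-- `T₁(a ⊗ b) = Δ(a)(1 ⊗ b)`. -/
  T₁_spec : ∀ a b, incl (T₁ (a ⊗ₜ b)) = Δ a * tmul 1 (incl b)
  /-- `T₂(a ⊗ b) = (a ⊗ 1)Δ(b)`. -/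
  T₂_spec : ∀ a b, incl (T₂ (a ⊗ₜ b)) = tmul (incl a) 1 * Δ b
  /-- `(c ⊗ 1 ⊗ 1)(Δ ⊗ ι)(Δ(a)(1 ⊗ b)) = (ι ⊗ Δ)((c ⊗ 1)Δ(a))(1 ⊗ 1 ⊗ b)`. -/
  coassoc : ∀ a b c,
    TensorProduct.assoc ℂ A A A
        (TensorProduct.map (T₂ ∘ₗ TensorProduct.mk ℂ A A c) LinearMap.id (T₁ (a ⊗ₜ b))) =
      TensorProduct.map LinearMap.id (T₁ ∘ₗ (TensorProduct.mk ℂ A A).flip b) (T₂ (c ⊗ₜ a))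

/-- A weak multiplier Hopf algebra. The maps `T₁`, `T₂` and the counit, `E`, `G₁`, `G₂` are all
uniquely determined by the coproduct. -/
structure WeakMultiplierHopfAlgebra (A : Type*) [NonUnitalRing A] [Module ℂ A]
    [IsScalarTower ℂ A A] [SMulCommClass ℂ A A] extends Coproduct A where
  nondegenerate : NondegenerateProduct A
  idempotent : IdempotentAlgebra A
  /-- The left leg of `Δ` is all of `A`. -/
  full_left : ∀ V : Submodule ℂ A,
    LinearMap.range T₁ ≤
      LinearMap.range (TensorProduct.map V.subtype (LinearMap.id : A →ₗ[ℂ] A)) → V = ⊤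
  /-- The right leg of `Δ` is all of `A`. -/
  full_right : ∀ W : Submodule ℂ A,
    LinearMap.range T₂ ≤
      LinearMap.range (TensorProduct.map (LinearMap.id : A →ₗ[ℂ] A) W.subtype) → W = ⊤
  /-- The counit. -/
  ε : A →ₗ[ℂ] ℂ
  counit_left : ∀ a b, sliceLeft ε (T₁ (a ⊗ₜ b)) = a * b
  counit_right : ∀ a b, sliceRight ε (T₂ (a ⊗ₜ b)) = a * b
  /-- The canonical idempotent. -/
  E : MultAlg (A ⊗[ℂ] A)
  E_idempotent : E * E = E
  /-- `E(A ⊗ A) = T₁(A ⊗ A)`. -/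
  range_T₁ : LinearMap.range E.l = LinearMap.range T₁
  /-- `(A ⊗ A)E = T₂(A ⊗ A)`. -/
  range_T₂ : LinearMap.range E.r = LinearMap.range T₂
  /-- `(ι ⊗ Δ)E = (E ⊗ 1)(1 ⊗ E) = (1 ⊗ E)(E ⊗ 1)`, where `Φ` is the (unique) extension of
  `ι ⊗ Δ` to a homomorphism on `M(A ⊗ A)` that maps `1` to `1 ⊗ E`. -/
  id_tensor_Δ_E : ∃ Φ : MultAlg (A ⊗[ℂ] A) →ₙₐ[ℂ] MultAlg (A ⊗[ℂ] (A ⊗[ℂ] A)),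
    (∀ a b : A, Φ (incl (a ⊗ₜ b)) = tmul (incl a) (Δ b)) ∧ Φ 1 = leg₂₃ E ∧
      Φ E = leg₁₂ E * leg₂₃ E ∧ Φ E = leg₂₃ E * leg₁₂ E
  G₁ : A ⊗[ℂ] A →ₗ[ℂ] A ⊗[ℂ] A
  G₂ : A ⊗[ℂ] A →ₗ[ℂ] A ⊗[ℂ] A
  /-- `(G₁ ⊗ ι)(Δ₁₃(a)(1 ⊗ b ⊗ c)) = Δ₁₃(a)(1 ⊗ E)(1 ⊗ b ⊗ c)`. -/
  G₁_spec : ∀ a b c, TensorProduct.map G₁ LinearMap.id (delta₁₃Right T₁ (a ⊗ₜ (b ⊗ₜ c))) =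
    delta₁₃Right T₁ (a ⊗ₜ E.l (b ⊗ₜ c))
  /-- `(ι ⊗ G₂)((a ⊗ b ⊗ 1)Δ₁₃(c)) = (a ⊗ b ⊗ 1)(E ⊗ 1)Δ₁₃(c)`. -/
  G₂_spec : ∀ a b c, TensorProduct.map LinearMap.id G₂ (delta₁₃Left T₂ ((a ⊗ₜ b) ⊗ₜ c)) =
    delta₁₃Left T₂ (E.r (a ⊗ₜ b) ⊗ₜ c)
  ker_T₁ : LinearMap.ker T₁ = LinearMap.range (LinearMap.id - G₁)
  ker_T₂ : LinearMap.ker T₂ = LinearMap.range (LinearMap.id - G₂)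

/-- A regular weak multiplier Hopf algebra: the coproduct is regular and `(A, Δᶜᵒᵖ)` is again a
weak multiplier Hopf algebra. -/
structure RegularWeakMultiplierHopfAlgebra (A : Type*) [NonUnitalRing A] [Module ℂ A]
    [IsScalarTower ℂ A A] [SMulCommClass ℂ A A] extends WeakMultiplierHopfAlgebra A where
  T₃ : A ⊗[ℂ] A →ₗ[ℂ] A ⊗[ℂ] A
  T₄ : A ⊗[ℂ] A →ₗ[ℂ] A ⊗[ℂ] A
  /-- `T₃(a ⊗ b) = (1 ⊗ b)Δ(a)`. -/
  T₃_spec : ∀ a b, incl (T₃ (a ⊗ₜ b)) = tmul 1 (incl b) * Δ a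
  /-- `T₄(a ⊗ b) = Δ(b)(a ⊗ 1)`. -/
  T₄_spec : ∀ a b, incl (T₄ (a ⊗ₜ b)) = Δ b * tmul (incl a) 1
  /-- `Δᶜᵒᵖ(a)x = fl(Δ(a) fl(x))` and `xΔᶜᵒᵖ(a) = fl(fl(x)Δ(a))`. -/
  cop : ∃ K : WeakMultiplierHopfAlgebra A, ∀ a x,
    (K.Δ a).l x = TensorProduct.comm ℂ A A ((Δ a).l (TensorProduct.comm ℂ A A x)) ∧
    (K.Δ a).r x = TensorProduct.comm ℂ A A ((Δ a).r (TensorProduct.comm ℂ A A x))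

namespace RegularWeakMultiplierHopfAlgebra

variable {A : Type*} [NonUnitalRing A] [Module ℂ A] [IsScalarTower ℂ A A] [SMulCommClass ℂ A A]

/-- `S` is the antipode: `R₁(a ⊗ b) = ∑ a₍₁₎ ⊗ S(a₍₂₎)b` and `R₂(a ⊗ b) = ∑ aS(b₍₁₎) ⊗ b₍₂₎` are
the generalized inverses of the canonical maps `T₁`, `T₂` that belong to the projections given by
`E` and `G₁`, respectively `E` and `G₂`. The two Sweedler formulas are covered by an extra factor
`c`: the first is multiplied by `c ⊗ 1` from the left, the second by `1 ⊗ c` from the right. -/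
def IsAntipode (H : RegularWeakMultiplierHopfAlgebra A) (S : A ≃ₗ[ℂ] A) : Prop :=
  ∃ R₁ R₂ : A ⊗[ℂ] A →ₗ[ℂ] A ⊗[ℂ] A,
    (H.T₁ ∘ₗ R₁ = H.E.l ∧ R₁ ∘ₗ H.T₁ = H.G₁ ∧ R₁ ∘ₗ H.T₁ ∘ₗ R₁ = R₁) ∧
    (H.T₂ ∘ₗ R₂ = H.E.r ∧ R₂ ∘ₗ H.T₂ = H.G₂ ∧ R₂ ∘ₗ H.T₂ ∘ₗ R₂ = R₂) ∧
    (∀ a b c, (tmul (incl c) 1).l (R₁ (a ⊗ₜ b)) =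
      TensorProduct.map LinearMap.id (LinearMap.mulRight ℂ b ∘ₗ S.toLinearMap)
        (H.T₂ (c ⊗ₜ a))) ∧
    (∀ a b c, (tmul 1 (incl c)).r (R₂ (a ⊗ₜ b)) =
      TensorProduct.map (LinearMap.mulLeft ℂ a ∘ₗ S.toLinearMap) LinearMap.id
        (H.T₁ (b ⊗ₜ c)))

/-- `εt` is the target map `A → M(A)`, `ε_t(a) = (ε ⊗ ι)(E(a ⊗ 1))`. -/
def IsTargetMap (H : RegularWeakMultiplierHopfAlgebra A) (εt : A →ₗ[ℂ] MultAlg A) : Prop :=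
  ∀ a b, (εt a).l b = sliceLeft H.ε (H.E.l (a ⊗ₜ b))

end RegularWeakMultiplierHopfAlgebra

/-! ### Module algebras -/

section Actions

variable {A : Type*} [NonUnitalRing A] [Module ℂ A] [IsScalarTower ℂ A A] [SMulCommClass ℂ A A]

/-- A bilinear map `A × V → V`, `(a, v) ↦ a v`, is a left `A`-module structure. -/
def IsLeftAction {V : Type*} [AddCommGroup V] [Module ℂ V] (act : A →ₗ[ℂ] V →ₗ[ℂ] V) : Prop :=
  ∀ a b v, act (a * b) v = act a (act b v)

/-- The module is unital: `A V = V`. -/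
def IsUnitalAction {V : Type*} [AddCommGroup V] [Module ℂ V] (act : A →ₗ[ℂ] V →ₗ[ℂ] V) : Prop :=
  Submodule.span ℂ (Set.range fun p : A × V => act p.1 p.2) = ⊤

/-- The module is non-degenerate: `A v = 0` implies `v = 0`. -/
def IsNondegenerateAction {V : Type*} [AddCommGroup V] [Module ℂ V]
    (act : A →ₗ[ℂ] V →ₗ[ℂ] V) : Prop :=
  ∀ v, (∀ a, act a v = 0) → v = 0

/-- `R` is a left `A`-module algebra. The last condition is `a(xy) = ∑ (a₍₁₎x)(a₍₂₎y)`, that is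
`a(xy) = m(Δ(a)(x ⊗ y))` with `m` the product of `R` and `Δ(a) ∈ M(A ⊗ A)` acting on the unital
`A ⊗ A`-module `R ⊗ R` by `Δ(a)(bx ⊗ cy) = (Δ(a)(b ⊗ c))(x ⊗ y)`. -/
structure IsModuleAlgebra (H : WeakMultiplierHopfAlgebra A) {R : Type*} [NonUnitalRing R]
    [Module ℂ R] [IsScalarTower ℂ R R] [SMulCommClass ℂ R R]
    (act : A →ₗ[ℂ] R →ₗ[ℂ] R) : Prop where
  nondegenerate : NondegenerateProduct R
  isLeftAction : IsLeftAction act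
  isUnital : IsUnitalAction act
  act_mul : ∀ (a b c : A) (x y : R), act a (act b x * act c y) =
    LinearMap.mul' ℂ R
      (TensorProduct.map (act.flip x) (act.flip y) ((H.Δ a).l (b ⊗ₜ c)))

/-- `ρ` is the extension of a unital `A`-module to a unital `M(A)`-module. -/
def IsMultiplierExtension {V : Type*} [AddCommGroup V] [Module ℂ V]
    (act : A →ₗ[ℂ] V →ₗ[ℂ] V) (ρ : MultAlg A →ₐ[ℂ] Module.End ℂ V) : Prop :=
  ∀ a, ρ (incl a) = act a

end Actions

end

/-!
Each canonical map `T` has a generalized inverse `R`, determined by the two projections `E` and `G`.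
An operator on neighbouring legs of `A ⊗ A ⊗ A` that commutes with `T`, such as the other canonical
map by coassociativity, commutes with the projections and hence with `R`. The counit turns the
inverse `R₁` of `T₁` into the antipode, `S(c)y = (ε ⊗ ι)R₁(c ⊗ y)`; the same formula for the
co-opposite algebra gives the inverse of `S`.

The axioms also yield `a ∈ Aa`, so unital modules are non-degenerate. On `M(R)` the action is
`(am)r = ∑ a₍₁₎(m(S(a₍₂₎)r))`, read off from `R₁(a ⊗ c) = ∑ a₍₁₎ ⊗ S(a₍₂₎)c` for `r = cx`, and the
companion formula for `r(am)` is the same construction for the co-opposite algebra. The two sides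
form a multiplier because the inverses belonging to `A` and to its co-opposite commute on
neighbouring legs.
-/

noncomputable section

open MultAlg

/-! ### Slices of tensors -/

section Slices

variable {k V W V' W' : Type*} [CommSemiring k] [AddCommMonoid V'] [Module k V']
  [AddCommMonoid W'] [Module k W'] [AddCommMonoid V] [Module k V] [AddCommMonoid W] [Module k W]

/-- The slice `ω ⊗ ι : V ⊗ W → W` of a linear functional `ω` on the left leg;
`sliceLeft` is the case `V = W` over `ℂ`. -/
def leftSlice (ω : V →ₗ[k] k) : V ⊗[k] W →ₗ[k] W :=
  (TensorProduct.lid k W).toLinearMap ∘ₗ ω.rTensor W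

/-- The slice `ι ⊗ ω : V ⊗ W → V` of a linear functional `ω` on the right leg;
`sliceRight` is the case `V = W` over `ℂ`. -/
def rightSlice (ω : W →ₗ[k] k) : V ⊗[k] W →ₗ[k] V :=
  (TensorProduct.rid k V).toLinearMap ∘ₗ ω.lTensor V

@[simp] theorem leftSlice_tmul (ω : V →ₗ[k] k) (v : V) (w : W) :
    leftSlice ω (v ⊗ₜ[k] w) = ω v • w := by
  simp [leftSlice]

@[simp] theorem rightSlice_tmul (ω : W →ₗ[k] k) (v : V) (w : W) :
    rightSlice ω (v ⊗ₜ[k] w) = ω w • v := by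
  simp [rightSlice]

theorem leftSlice_lTensor (ω : V →ₗ[k] k) (f : W →ₗ[k] W') (z : V ⊗[k] W) :
    leftSlice ω (f.lTensor V z) = f (leftSlice ω z) :=
  LinearMap.congr_fun (show leftSlice ω ∘ₗ f.lTensor V = f ∘ₗ leftSlice ω by ext; simp) z

theorem rightSlice_rTensor (ω : W →ₗ[k] k) (f : V →ₗ[k] V') (z : V ⊗[k] W) :
    rightSlice ω (f.rTensor W z) = f (rightSlice ω z) :=
  LinearMap.congr_fun (show rightSlice ω ∘ₗ f.rTensor W = f ∘ₗ rightSlice ω by ext; simp) z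

theorem rightSlice_lTensor (ω : W' →ₗ[k] k) (f : W →ₗ[k] W') (z : V ⊗[k] W) :
    rightSlice ω (f.lTensor V z) = rightSlice (ω ∘ₗ f) z :=
  LinearMap.congr_fun (show rightSlice ω ∘ₗ f.lTensor V = rightSlice (ω ∘ₗ f) by ext; simp) z

theorem leftSlice_comm (ω : W →ₗ[k] k) (z : V ⊗[k] W) :
    leftSlice ω (TensorProduct.comm k V W z) = rightSlice ω z :=
  LinearMap.congr_fun (show leftSlice ω ∘ₗ (TensorProduct.comm k V W).toLinearMap = rightSlice ω by
    ext; simp) z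

theorem rightSlice_comm (ω : V →ₗ[k] k) (z : V ⊗[k] W) :
    rightSlice ω (TensorProduct.comm k V W z) = leftSlice ω z := by
  rw [← leftSlice_comm, TensorProduct.comm_comm]

theorem lTensor_rightSlice_assoc (ω : W' →ₗ[k] k) (w : (V ⊗[k] W) ⊗[k] W') :
    (rightSlice ω).lTensor V (TensorProduct.assoc k V W W' w) = rightSlice ω w :=
  LinearMap.congr_fun (show (rightSlice ω).lTensor V ∘ₗ (TensorProduct.assoc k V W W').toLinearMap =
    rightSlice ω by ext; simp) w

theorem lTensor_rTensor_apply (f : W →ₗ[k] W') (g : V →ₗ[k] V') (z : V ⊗[k] W) :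
    f.lTensor V' (g.rTensor W z) = g.rTensor W' (f.lTensor V z) := by
  rw [← LinearMap.comp_apply, ← LinearMap.comp_apply, LinearMap.lTensor_comp_rTensor,
    LinearMap.rTensor_comp_lTensor]

end Slices

section Separation

variable {k V W V' W' : Type*} [Field k] [AddCommGroup V] [Module k V] [AddCommGroup W]
  [Module k W] [AddCommGroup V'] [Module k V'] [AddCommGroup W'] [Module k W']

theorem eq_zero_of_rightSlice {z : V ⊗[k] W} (h : ∀ ω : W →ₗ[k] k, rightSlice ω z = 0) :
    z = 0 := by
  classical
  apply (TensorProduct.equivFinsuppOfBasisRight (Module.Basis.ofVectorSpace k W)).injective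
  ext i
  rw [TensorProduct.equivFinsuppOfBasisRight_apply, map_zero]
  exact h _

theorem eq_zero_of_leftSlice {z : V ⊗[k] W} (h : ∀ ω : V →ₗ[k] k, leftSlice ω z = 0) :
    z = 0 :=
  (TensorProduct.comm k V W).map_eq_zero_iff.mp <|
    eq_zero_of_rightSlice fun ω => by rw [rightSlice_comm, h]

theorem eq_of_rightSlice {z z' : V ⊗[k] W}
    (h : ∀ ω : W →ₗ[k] k, rightSlice ω z = rightSlice ω z') : z = z' :=
  sub_eq_zero.mp <| eq_zero_of_rightSlice fun ω => by rw [map_sub, h, sub_self]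

theorem eq_of_rTensor {ι : Sort*} (f : ι → V →ₗ[k] V') (hf : ∀ v, (∀ i, f i v = 0) → v = 0)
    {z z' : V ⊗[k] W} (h : ∀ i, (f i).rTensor W z = (f i).rTensor W z') : z = z' := by
  rw [← sub_eq_zero]
  refine eq_zero_of_rightSlice fun ω => hf _ fun i => ?_
  rw [← rightSlice_rTensor, map_sub, h, sub_self, map_zero]

theorem eq_of_lTensor {ι : Sort*} (f : ι → W →ₗ[k] W') (hf : ∀ w, (∀ i, f i w = 0) → w = 0)
    {z z' : V ⊗[k] W} (h : ∀ i, (f i).lTensor V z = (f i).lTensor V z') : z = z' := by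
  rw [← sub_eq_zero]
  refine eq_zero_of_leftSlice fun ω => hf _ fun i => ?_
  rw [← leftSlice_lTensor, map_sub, h, sub_self, map_zero]

theorem lift_eq_zero_of_rightSlice (B : V →ₗ[k] W →ₗ[k] W') {z : V ⊗[k] W}
    (h : ∀ ω : W →ₗ[k] k, B (rightSlice ω z) = 0) : TensorProduct.lift B z = 0 := by
  have hB : TensorProduct.lift B = TensorProduct.lift LinearMap.id ∘ₗ B.rTensor W := by ext; simp
  have hz : B.rTensor W z = 0 := eq_zero_of_rightSlice fun ω => by rw [rightSlice_rTensor, h]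
  rw [hB, LinearMap.comp_apply, hz, map_zero]

end Separation

/-! ### Generalized inverses -/

/-- `R` is the generalized inverse of `T` (`T R T = T` and `R T R = R`) with the prescribed
projections `P = T R` and `G = R T`. -/
structure IsGenInv {M : Type*} [Monoid M] (T P G R : M) : Prop where
  mul_right : T * R = P
  mul_left : R * T = G
  refl : R * T * R = R

namespace IsGenInv

theorem map {M N F : Type*} [Monoid M] [Monoid N] [FunLike F M N] [MulHomClass F M N] {T P G R : M}
    (h : IsGenInv T P G R) (φ : F) : IsGenInv (φ T) (φ P) (φ G) (φ R) where
  mul_right := by rw [← map_mul, h.mul_right]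
  mul_left := by rw [← map_mul, h.mul_left]
  refl := by rw [← map_mul, ← map_mul, h.refl]

theorem commute {M : Type*} [Monoid M] {T P G R X : M} (h : IsGenInv T P G R)
    (hT : Commute X T) (hP : Commute X P) (hG : Commute X G) : Commute X R := by
  obtain ⟨rfl, rfl, hR⟩ := h
  calc X * R = X * (R * T) * R := by rw [mul_assoc, hR]
    _ = R * (T * X) * R := by rw [hG.eq]; simp only [mul_assoc]
    _ = R * (X * (T * R)) := by rw [← hT.eq]; simp only [mul_assoc]
    _ = R * T * R * X := by rw [hP.eq]; simp only [mul_assoc]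
    _ = R * X := by rw [hR]

section Module

variable {k V : Type*} [Semiring k] [AddCommMonoid V] [Module k V] {T P G R : Module.End k V}
  (h : IsGenInv T P G R)
include h

theorem apply_right (v : V) : T (R v) = P v := LinearMap.congr_fun h.mul_right v

theorem apply_left (v : V) : R (T v) = G v := LinearMap.congr_fun h.mul_left v

theorem proj_left (v : V) : G (R v) = R v := by
  rw [← h.apply_left]
  exact LinearMap.congr_fun h.refl v

theorem proj_right (v : V) : R (P v) = R v := by
  rw [← h.apply_right, h.apply_left, h.proj_left]

end Module

end IsGenInv

/-- `T` restricts to a bijection from the range of `G` to the range of `P`; `R` inverts it. -/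
theorem exists_isGenInv {k V : Type*} [Ring k] [AddCommGroup V] [Module k V]
    {T P G : Module.End k V} (hP : IsIdempotentElem P) (hG : IsIdempotentElem G)
    (hrange : LinearMap.range P = LinearMap.range T) (hker : LinearMap.ker T = LinearMap.ker G) :
    ∃ R, IsGenInv T P G R := by
  have hPP (v : V) : P (P v) = P v := LinearMap.congr_fun hP v
  have hGG (v : V) : G (G v) = G v := LinearMap.congr_fun hG v
  have hPT (v : V) : P (T v) = T v := by
    obtain ⟨w, hw⟩ : T v ∈ LinearMap.range P := hrange ▸ LinearMap.mem_range_self T v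
    rw [← hw, hPP]
  have hTG (v : V) : T (G v) = T v := by
    have : G v - v ∈ LinearMap.ker T := by simp [hker, hGG]
    rwa [LinearMap.mem_ker, map_sub, sub_eq_zero] at this
  let T₀ : LinearMap.range G →ₗ[k] LinearMap.range P :=
    (T ∘ₗ (LinearMap.range G).subtype).codRestrict _ fun v => hrange ▸ LinearMap.mem_range_self T _
  have hT₀ : Function.Bijective T₀ := by
    refine ⟨(injective_iff_map_eq_zero T₀).mpr ?_, ?_⟩
    · rintro ⟨_, v, rfl⟩ hv
      have : G v ∈ LinearMap.ker G := hker ▸ congrArg Subtype.val hv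
      exact Subtype.ext ((hGG v).symm.trans this)
    · rintro ⟨w, hw⟩
      obtain ⟨v, rfl⟩ := hrange ▸ hw
      exact ⟨⟨G v, LinearMap.mem_range_self G v⟩, Subtype.ext (hTG v)⟩
  let e := LinearEquiv.ofBijective T₀ hT₀
  let R : Module.End k V := (LinearMap.range G).subtype ∘ₗ e.symm.toLinearMap ∘ₗ P.rangeRestrict
  have hTR : T * R = P :=
    LinearMap.ext fun v => congrArg Subtype.val (e.apply_symm_apply (P.rangeRestrict v))
  have hRT : R * T = G := by
    refine LinearMap.ext fun v => congrArg Subtype.val (e.symm_apply_eq.mpr (Subtype.ext ?_) :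
      e.symm (P.rangeRestrict (T v)) = G.rangeRestrict v)
    exact (hPT v).trans (hTG v).symm
  refine ⟨R, hTR, hRT, LinearMap.ext fun v => ?_⟩
  rw [hRT]
  exact (LinearMap.IsIdempotentElem.mem_range_iff hG).mp (e.symm (P.rangeRestrict v)).2

/-! ### Operators on legs of a threefold tensor product -/

section LegOperators

variable {k A M N : Type*} [CommSemiring k] [AddCommMonoid A] [Module k A] [AddCommMonoid M]
  [Module k M] [AddCommMonoid N] [Module k N]

variable (M) in
/-- An operator on `A ⊗ A`, acting on the first two legs of `A ⊗ A ⊗ M`. -/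
def onLegs₁₂ : Module.End k (A ⊗[k] A) →ₐ[k] Module.End k (A ⊗[k] (A ⊗[k] M)) :=
  ((TensorProduct.assoc k A A M).conjAlgEquiv k).toAlgHom.comp (Module.End.rTensorAlgHom k _ _)

theorem onLegs₁₂_apply (f : Module.End k (A ⊗[k] A)) (w : A ⊗[k] (A ⊗[k] M)) :
    onLegs₁₂ M f w =
      TensorProduct.assoc k A A M (f.rTensor M ((TensorProduct.assoc k A A M).symm w)) := rfl

theorem onLegs₁₂_assoc (f : Module.End k (A ⊗[k] A)) (z : A ⊗[k] A) (m : M) :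
    onLegs₁₂ M f (TensorProduct.assoc k A A M (z ⊗ₜ m)) =
      TensorProduct.assoc k A A M (f z ⊗ₜ m) := by
  rw [onLegs₁₂_apply, LinearEquiv.symm_apply_apply, LinearMap.rTensor_tmul]

@[simp] theorem onLegs₁₂_tmul (f : Module.End k (A ⊗[k] A)) (x a : A) (m : M) :
    onLegs₁₂ M f (x ⊗ₜ (a ⊗ₜ m)) = TensorProduct.assoc k A A M (f (x ⊗ₜ a) ⊗ₜ m) :=
  onLegs₁₂_assoc f (x ⊗ₜ a) m

theorem lTensor_lTensor_assoc (g : M →ₗ[k] N) (z : A ⊗[k] A) (m : M) :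
    (g.lTensor A).lTensor A (TensorProduct.assoc k A A M (z ⊗ₜ m)) =
      TensorProduct.assoc k A A N (z ⊗ₜ g m) := by
  induction z with
  | zero => simp
  | add x y hx hy => simp only [TensorProduct.add_tmul, map_add, hx, hy]
  | tmul x a => simp

theorem onLegs₁₂_lTensor_lTensor (f : Module.End k (A ⊗[k] A)) (g : M →ₗ[k] N)
    (w : A ⊗[k] (A ⊗[k] M)) :
    onLegs₁₂ N f ((g.lTensor A).lTensor A w) = (g.lTensor A).lTensor A (onLegs₁₂ M f w) := by
  refine LinearMap.congr_fun (?_ : onLegs₁₂ N f ∘ₗ (g.lTensor A).lTensor A =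
    (g.lTensor A).lTensor A ∘ₗ onLegs₁₂ M f) w
  ext x a m
  simp [lTensor_lTensor_assoc]

theorem lTensor_rightSlice_onLegs₁₂ (ω : M →ₗ[k] k) (f : Module.End k (A ⊗[k] A))
    (w : A ⊗[k] (A ⊗[k] M)) :
    (rightSlice ω).lTensor A (onLegs₁₂ M f w) = f ((rightSlice ω).lTensor A w) := by
  refine LinearMap.congr_fun (?_ : (rightSlice ω).lTensor A ∘ₗ onLegs₁₂ M f =
    f ∘ₗ (rightSlice ω).lTensor A) w
  ext x a m
  simp [lTensor_rightSlice_assoc]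

/-- `f`, acting on the first two legs of `A ⊗ A ⊗ A`, commutes with `g`, acting on the last two. -/
def LegComm (f g : Module.End k (A ⊗[k] A)) : Prop :=
  Commute (onLegs₁₂ A f) (g.lTensor A : Module.End k (A ⊗[k] (A ⊗[k] A)))

namespace LegComm

variable {f g T P G R : Module.End k (A ⊗[k] A)}

theorem apply (h : LegComm f g) (w : A ⊗[k] (A ⊗[k] A)) :
    onLegs₁₂ A f (g.lTensor A w) = g.lTensor A (onLegs₁₂ A f w) :=
  LinearMap.congr_fun h.eq w

theorem of_apply (h : ∀ x a y, onLegs₁₂ A f (x ⊗ₜ g (a ⊗ₜ y)) =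
    g.lTensor A (TensorProduct.assoc k A A A (f (x ⊗ₜ a) ⊗ₜ y))) : LegComm f g := by
  unfold LegComm Commute SemiconjBy
  ext x a y
  simp [Module.End.mul_apply, h]

theorem genInv_right (hR : IsGenInv T P G R) (hT : LegComm f T) (hP : LegComm f P)
    (hG : LegComm f G) : LegComm f R :=
  (hR.map (Module.End.lTensorAlgHom k (A ⊗[k] A) A)).commute hT hP hG

theorem genInv_left (hR : IsGenInv T P G R) (hT : LegComm T g) (hP : LegComm P g)
    (hG : LegComm G g) : LegComm R g :=
  ((hR.map (onLegs₁₂ A)).commute hT.symm hP.symm hG.symm).symm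

end LegComm

/-- The conjugate of an operator on `A ⊗ A` by the flip. -/
def flipConj (f : Module.End k (A ⊗[k] A)) : Module.End k (A ⊗[k] A) :=
  (TensorProduct.comm k A A).conj f

theorem flipConj_apply (f : Module.End k (A ⊗[k] A)) (z : A ⊗[k] A) :
    flipConj f z = TensorProduct.comm k A A (f (TensorProduct.comm k A A z)) := rfl

@[simp] theorem flipConj_tmul (f : Module.End k (A ⊗[k] A)) (a b : A) :
    flipConj f (a ⊗ₜ b) = TensorProduct.comm k A A (f (b ⊗ₜ a)) := rfl

theorem flipConj_flipConj (f : Module.End k (A ⊗[k] A)) : flipConj (flipConj f) = f := by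
  ext; simp

variable (k A) in
/-- The reversal `a ⊗ b ⊗ c ↦ c ⊗ b ⊗ a`, which exchanges the roles of the first two and the last
two legs. -/
def reverseLegs : A ⊗[k] (A ⊗[k] A) ≃ₗ[k] A ⊗[k] (A ⊗[k] A) :=
  TensorProduct.comm k A (A ⊗[k] A) ≪≫ₗ
    TensorProduct.congr (TensorProduct.comm k A A) (LinearEquiv.refl k A) ≪≫ₗ
      TensorProduct.assoc k A A A

theorem reverseLegs_tmul (a : A) (z : A ⊗[k] A) :
    reverseLegs k A (a ⊗ₜ z) = TensorProduct.assoc k A A A (TensorProduct.comm k A A z ⊗ₜ a) := rfl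

theorem reverseLegs_assoc (c : A) (z : A ⊗[k] A) :
    reverseLegs k A (TensorProduct.assoc k A A A (z ⊗ₜ c)) = c ⊗ₜ TensorProduct.comm k A A z := by
  induction z with
  | zero => simp
  | add x y hx hy => simp only [TensorProduct.add_tmul, TensorProduct.tmul_add, map_add, hx, hy]
  | tmul x a => simp [reverseLegs]

theorem reverseLegs_onLegs₁₂ (f : Module.End k (A ⊗[k] A)) (w : A ⊗[k] (A ⊗[k] A)) :
    reverseLegs k A (onLegs₁₂ A f w) = (flipConj f).lTensor A (reverseLegs k A w) := by
  refine LinearMap.congr_fun (?_ : (reverseLegs k A).toLinearMap ∘ₗ onLegs₁₂ A f =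
    (flipConj f).lTensor A ∘ₗ (reverseLegs k A).toLinearMap) w
  ext a b c
  simp [reverseLegs_assoc, reverseLegs_tmul]

theorem reverseLegs_lTensor (f : Module.End k (A ⊗[k] A)) (w : A ⊗[k] (A ⊗[k] A)) :
    reverseLegs k A (f.lTensor A w) = onLegs₁₂ A (flipConj f) (reverseLegs k A w) := by
  refine LinearMap.congr_fun (?_ : (reverseLegs k A).toLinearMap ∘ₗ f.lTensor A =
    onLegs₁₂ A (flipConj f) ∘ₗ (reverseLegs k A).toLinearMap) w
  ext a b c
  simp [reverseLegs_tmul]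

theorem LegComm.flipConj {f g : Module.End k (A ⊗[k] A)} (h : LegComm f g) :
    LegComm (flipConj g) (flipConj f) := by
  refine LinearMap.ext fun w => ?_
  obtain ⟨w, rfl⟩ := (reverseLegs k A).surjective w
  have := congrArg (reverseLegs k A) (h.apply w)
  rw [reverseLegs_onLegs₁₂, reverseLegs_lTensor, reverseLegs_lTensor, reverseLegs_onLegs₁₂] at this
  exact this.symm

theorem LegComm.of_flipConj {f g : Module.End k (A ⊗[k] A)}
    (h : LegComm (_root_.flipConj g) (_root_.flipConj f)) : LegComm f g := by
  simpa only [flipConj_flipConj] using h.flipConj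

end LegOperators

/-! ### The projection attached to a canonical map -/

section CanonicalProjection

variable {A : Type*} [AddCommGroup A] [Module ℂ A]

/-- The left leg of the operator `T` on `A ⊗ A` is all of `A`: the range of `T` lies in no `V ⊗ A`
with `V` a proper subspace. -/
def HasFullLeftLeg (T : Module.End ℂ (A ⊗[ℂ] A)) : Prop :=
  ∀ V : Submodule ℂ A, LinearMap.range T ≤
    LinearMap.range (TensorProduct.map V.subtype (LinearMap.id : A →ₗ[ℂ] A)) → V = ⊤

theorem HasFullLeftLeg.eq_zero {T : Module.End ℂ (A ⊗[ℂ] A)} (hT : HasFullLeftLeg T)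
    {V : Type*} [AddCommGroup V] [Module ℂ V] (f : A →ₗ[ℂ] V)
    (hf : ∀ a c, f.rTensor A (T (a ⊗ₜ c)) = 0) : f = 0 := by
  have hfT : f.rTensor A ∘ₗ T = 0 := TensorProduct.ext' hf
  rw [← LinearMap.ker_eq_top]
  apply hT
  rintro _ ⟨w, rfl⟩
  exact (Module.Flat.rTensor_exact A (LinearMap.exact_subtype_ker_map f) (T w)).mp
    (LinearMap.congr_fun hfT w)

/-- `T` is a canonical map with full left leg, `P` a projection on its range, and `G` is the
operator with `(G ⊗ ι)T₁₃ = T₁₃P₂₃` whose complement is the projection on the kernel of `T`. -/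
structure IsCanonicalMap (T P G : Module.End ℂ (A ⊗[ℂ] A)) : Prop where
  full : HasFullLeftLeg T
  idem : IsIdempotentElem P
  range_eq : LinearMap.range P = LinearMap.range T
  spec : ∀ a b c, TensorProduct.map G LinearMap.id (delta₁₃Right T (a ⊗ₜ (b ⊗ₜ c))) =
    delta₁₃Right T (a ⊗ₜ P (b ⊗ₜ c))
  ker_eq : LinearMap.ker T = LinearMap.range (LinearMap.id - G)

/-- The slice `a ⊗ (b ⊗ c) ↦ (ι ⊗ ω)(T(a ⊗ c)) ⊗ b` of the last leg of `T₁₃`. -/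
def slice₁₃ (T : Module.End ℂ (A ⊗[ℂ] A)) (ω : A →ₗ[ℂ] ℂ) :
    A ⊗[ℂ] (A ⊗[ℂ] A) →ₗ[ℂ] A ⊗[ℂ] A :=
  rightSlice ω ∘ₗ delta₁₃Right T

@[simp] theorem slice₁₃_tmul (T : Module.End ℂ (A ⊗[ℂ] A)) (ω : A →ₗ[ℂ] ℂ) (a b c : A) :
    slice₁₃ T ω (a ⊗ₜ (b ⊗ₜ c)) = rightSlice ω (T (a ⊗ₜ c)) ⊗ₜ b := by
  simp only [slice₁₃, delta₁₃Right, LinearMap.comp_apply, LinearEquiv.coe_coe,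
    TensorProduct.leftComm_tmul, TensorProduct.map_tmul, LinearMap.id_apply]
  induction T (a ⊗ₜ c) with
  | zero => simp
  | add x y hx hy => simp only [TensorProduct.add_tmul, TensorProduct.tmul_add, map_add, hx, hy]
  | tmul x y => simp [TensorProduct.smul_tmul']

theorem lTensor_slice₁₃_assoc (T : Module.End ℂ (A ⊗[ℂ] A)) (ω : A →ₗ[ℂ] ℂ) (z : A ⊗[ℂ] A)
    (b c : A) :
    (slice₁₃ T ω).lTensor A (TensorProduct.assoc ℂ A A _ (z ⊗ₜ (b ⊗ₜ c))) =
      TensorProduct.assoc ℂ A A A ((rightSlice ω).lTensor A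
        (T.lTensor A (TensorProduct.assoc ℂ A A A (z ⊗ₜ c))) ⊗ₜ b) := by
  induction z with
  | zero => simp
  | add z z' hz hz' => simp only [TensorProduct.add_tmul, map_add, hz, hz']
  | tmul x y => simp

theorem LegComm.onLegs₁₂_lTensor_slice₁₃ {f T : Module.End ℂ (A ⊗[ℂ] A)} (hf : LegComm f T)
    (ω : A →ₗ[ℂ] ℂ) (w : A ⊗[ℂ] (A ⊗[ℂ] (A ⊗[ℂ] A))) :
    onLegs₁₂ A f ((slice₁₃ T ω).lTensor A w) =
      (slice₁₃ T ω).lTensor A (onLegs₁₂ (A ⊗[ℂ] A) f w) := by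
  refine LinearMap.congr_fun (?_ : onLegs₁₂ A f ∘ₗ (slice₁₃ T ω).lTensor A =
    (slice₁₃ T ω).lTensor A ∘ₗ onLegs₁₂ (A ⊗[ℂ] A) f) w
  ext x a b c
  have hfT : (rightSlice ω).lTensor A (T.lTensor A (TensorProduct.assoc ℂ A A A
      (f (x ⊗ₜ a) ⊗ₜ c))) = f (x ⊗ₜ rightSlice ω (T (a ⊗ₜ c))) := by
    rw [← onLegs₁₂_tmul, ← hf.apply, lTensor_rightSlice_onLegs₁₂, LinearMap.lTensor_tmul,
      LinearMap.lTensor_tmul]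
  simp [lTensor_slice₁₃_assoc, hfT]

namespace IsCanonicalMap

variable {T P G : Module.End ℂ (A ⊗[ℂ] A)} (h : IsCanonicalMap T P G)
include h

theorem proj_slice₁₃ (ω : A →ₗ[ℂ] ℂ) (w : A ⊗[ℂ] (A ⊗[ℂ] A)) :
    G (slice₁₃ T ω w) = slice₁₃ T ω (P.lTensor A w) := by
  refine LinearMap.congr_fun (?_ : G ∘ₗ slice₁₃ T ω = slice₁₃ T ω ∘ₗ P.lTensor A) w
  ext a b c
  exact (rightSlice_rTensor ω G _).symm.trans (congrArg (rightSlice ω) (h.spec a b c))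

theorem ext_slice₁₃ {V : Type*} [AddCommGroup V] [Module ℂ V] {f g : A ⊗[ℂ] A →ₗ[ℂ] V}
    (hfg : ∀ ω w, f (slice₁₃ T ω w) = g (slice₁₃ T ω w)) : f = g := by
  rw [← sub_eq_zero]
  suffices hs : ∀ b, (f - g) ∘ₗ (TensorProduct.mk ℂ A A).flip b = 0 from
    TensorProduct.ext' fun a b => LinearMap.congr_fun (hs b) a
  intro b
  refine h.full.eq_zero _ fun a c => eq_zero_of_rightSlice fun ω => ?_
  have := hfg ω (a ⊗ₜ (b ⊗ₜ c))
  rw [slice₁₃_tmul] at this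
  simp [rightSlice_rTensor, this]

theorem isIdempotentElem_proj : IsIdempotentElem G := by
  refine h.ext_slice₁₃ fun ω w => ?_
  rw [Module.End.mul_apply, h.proj_slice₁₃, h.proj_slice₁₃, ← LinearMap.comp_apply (P.lTensor A),
    ← LinearMap.lTensor_comp, ← Module.End.mul_eq_comp, h.idem.eq]

theorem exists_isGenInv : ∃ R, IsGenInv T P G R :=
  _root_.exists_isGenInv h.idem h.isIdempotentElem_proj h.range_eq <| by
    rw [h.ker_eq, LinearMap.IsIdempotentElem.ker_eq_range_one_sub h.isIdempotentElem_proj]; rfl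

theorem legComm_proj {f : Module.End ℂ (A ⊗[ℂ] A)} (hf : LegComm f T) : LegComm f G := by
  have hG (ω : A →ₗ[ℂ] ℂ) (w : A ⊗[ℂ] (A ⊗[ℂ] (A ⊗[ℂ] A))) :
      G.lTensor A ((slice₁₃ T ω).lTensor A w) =
        (slice₁₃ T ω).lTensor A ((P.lTensor A).lTensor A w) := by
    rw [← LinearMap.lTensor_comp_apply, ← LinearMap.lTensor_comp_apply,
      LinearMap.ext (h.proj_slice₁₃ ω) (f := G ∘ₗ slice₁₃ T ω) (g := slice₁₃ T ω ∘ₗ P.lTensor A)]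
  refine TensorProduct.ext' fun x => LinearMap.congr_fun
    (f := (onLegs₁₂ A f ∘ₗ G.lTensor A) ∘ₗ TensorProduct.mk ℂ A _ x)
    (g := (G.lTensor A ∘ₗ onLegs₁₂ A f) ∘ₗ TensorProduct.mk ℂ A _ x)
    (h.ext_slice₁₃ fun ω w => ?_)
  simp only [LinearMap.comp_apply, TensorProduct.mk_apply,
    ← LinearMap.lTensor_tmul A (slice₁₃ T ω)]
  rw [hG, hf.onLegs₁₂_lTensor_slice₁₃, hf.onLegs₁₂_lTensor_slice₁₃, hG, onLegs₁₂_lTensor_lTensor]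

end IsCanonicalMap

end CanonicalProjection

/-! ### Multipliers of tensor products -/

namespace NondegenerateProduct

variable {A : Type*} [NonUnitalRing A]

theorem eq_of_mul_right (hA : NondegenerateProduct A) {x y : A} (h : ∀ w, x * w = y * w) :
    x = y :=
  sub_eq_zero.mp <| hA.1 _ fun w => by rw [sub_mul, h, sub_self]

theorem eq_of_mul_left (hA : NondegenerateProduct A) {x y : A} (h : ∀ w, w * x = w * y) :
    x = y :=
  sub_eq_zero.mp <| hA.2 _ fun w => by rw [mul_sub, h, sub_self]

end NondegenerateProduct

section OneLeggedMultiplication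

variable {A V : Type*} [NonUnitalRing A] [Module ℂ A] [AddCommGroup V] [Module ℂ V]

/-- Left multiplication `z ↦ (c ⊗ 1)z` on `A ⊗ V`. -/
abbrev mulLeft₁ [SMulCommClass ℂ A A] (c : A) : A ⊗[ℂ] V →ₗ[ℂ] A ⊗[ℂ] V :=
  (LinearMap.mulLeft ℂ c).rTensor V

/-- Left multiplication `z ↦ (1 ⊗ c)z` on `V ⊗ A`. -/
abbrev mulLeft₂ [SMulCommClass ℂ A A] (c : A) : V ⊗[ℂ] A →ₗ[ℂ] V ⊗[ℂ] A :=
  (LinearMap.mulLeft ℂ c).lTensor V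

/-- Right multiplication `z ↦ z(c ⊗ 1)` on `A ⊗ V`. -/
abbrev mulRight₁ [IsScalarTower ℂ A A] (c : A) : A ⊗[ℂ] V →ₗ[ℂ] A ⊗[ℂ] V :=
  (LinearMap.mulRight ℂ c).rTensor V

/-- Right multiplication `z ↦ z(1 ⊗ c)` on `V ⊗ A`. -/
abbrev mulRight₂ [IsScalarTower ℂ A A] (c : A) : V ⊗[ℂ] A →ₗ[ℂ] V ⊗[ℂ] A :=
  (LinearMap.mulRight ℂ c).lTensor V

theorem mulLeft₁_mulLeft₁ [SMulCommClass ℂ A A] (c d : A) (z : A ⊗[ℂ] V) :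
    mulLeft₁ c (mulLeft₁ d z) = mulLeft₁ (c * d) z := by
  rw [← LinearMap.rTensor_comp_apply, mulLeft₁, LinearMap.mulLeft_mul]

theorem comm_mulLeft₁ [SMulCommClass ℂ A A] (c : A) (z : A ⊗[ℂ] V) :
    TensorProduct.comm ℂ A V (mulLeft₁ c z) = mulLeft₂ c (TensorProduct.comm ℂ A V z) :=
  (LinearMap.lTensor_comm _ z).symm

theorem comm_mulRight₁ [IsScalarTower ℂ A A] (c : A) (z : A ⊗[ℂ] V) :
    TensorProduct.comm ℂ A V (mulRight₁ c z) = mulRight₂ c (TensorProduct.comm ℂ A V z) :=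
  (LinearMap.lTensor_comm _ z).symm

theorem comm_mulRight₂ [IsScalarTower ℂ A A] (c : A) (z : V ⊗[ℂ] A) :
    TensorProduct.comm ℂ V A (mulRight₂ c z) = mulRight₁ c (TensorProduct.comm ℂ V A z) :=
  (LinearMap.rTensor_comm _ z).symm

namespace NondegenerateProduct

variable (hA : NondegenerateProduct A)
include hA

theorem eq_of_mulLeft₁ [SMulCommClass ℂ A A] {z z' : A ⊗[ℂ] V}
    (h : ∀ c, mulLeft₁ c z = mulLeft₁ c z') : z = z' :=
  eq_of_rTensor (fun c : A => LinearMap.mulLeft ℂ c) (fun v hv => hA.2 v hv) h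

theorem eq_of_mulRight₁ [IsScalarTower ℂ A A] {z z' : A ⊗[ℂ] V}
    (h : ∀ c, mulRight₁ c z = mulRight₁ c z') : z = z' :=
  eq_of_rTensor (fun c : A => LinearMap.mulRight ℂ c) (fun v hv => hA.1 v hv) h

theorem eq_of_mulLeft₂ [SMulCommClass ℂ A A] {z z' : V ⊗[ℂ] A}
    (h : ∀ c, mulLeft₂ c z = mulLeft₂ c z') : z = z' :=
  eq_of_lTensor (fun c : A => LinearMap.mulLeft ℂ c) (fun v hv => hA.2 v hv) h

theorem eq_of_mulRight₂ [IsScalarTower ℂ A A] {z z' : V ⊗[ℂ] A}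
    (h : ∀ c, mulRight₂ c z = mulRight₂ c z') : z = z' :=
  eq_of_lTensor (fun c : A => LinearMap.mulRight ℂ c) (fun v hv => hA.1 v hv) h

end NondegenerateProduct

end OneLeggedMultiplication

section TensorAlgebra

variable {A : Type*} [NonUnitalRing A] [Module ℂ A] [IsScalarTower ℂ A A] [SMulCommClass ℂ A A]
  {B : Type*} [NonUnitalRing B] [Module ℂ B] [IsScalarTower ℂ B B] [SMulCommClass ℂ B B]

theorem mul_tmul_eq (z : A ⊗[ℂ] B) (x : A) (y : B) :
    z * (x ⊗ₜ y) = mulRight₁ x (mulRight₂ y z) := by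
  induction z with
  | zero => simp
  | add z z' hz hz' => simp only [add_mul, map_add, hz, hz']
  | tmul a b => simp

theorem tmul_mul_eq (z : A ⊗[ℂ] B) (x : A) (y : B) :
    (x ⊗ₜ y) * z = mulLeft₁ x (mulLeft₂ y z) := by
  induction z with
  | zero => simp
  | add z z' hz hz' => simp only [mul_add, map_add, hz, hz']
  | tmul a b => simp

theorem comm_mul (z w : A ⊗[ℂ] B) : TensorProduct.comm ℂ A B (z * w) =
    TensorProduct.comm ℂ A B z * TensorProduct.comm ℂ A B w := by
  induction w with
  | zero => simp
  | add w w' hw hw' => simp only [mul_add, map_add, hw, hw']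
  | tmul a b =>
    rw [mul_tmul_eq, comm_mulRight₁, comm_mulRight₂, TensorProduct.comm_tmul, mul_tmul_eq,
      lTensor_rTensor_apply]

theorem NondegenerateProduct.tensor (hA : NondegenerateProduct A) (hB : NondegenerateProduct B) :
    NondegenerateProduct (A ⊗[ℂ] B) := by
  refine ⟨fun z hz => hB.eq_of_mulRight₂ fun y => hA.eq_of_mulRight₁ fun x => ?_,
    fun z hz => hB.eq_of_mulLeft₂ fun y => hA.eq_of_mulLeft₁ fun x => ?_⟩
  · rw [← mul_tmul_eq, hz, map_zero, map_zero]
  · rw [← tmul_mul_eq, hz, map_zero, map_zero]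

end TensorAlgebra

namespace MultAlg

variable {A : Type*} [NonUnitalRing A] [Module ℂ A] [IsScalarTower ℂ A A] [SMulCommClass ℂ A A]
  {B : Type*} [NonUnitalRing B] [Module ℂ B] [IsScalarTower ℂ B B] [SMulCommClass ℂ B B]

@[simp] theorem mul_l (m n : MultAlg A) (a : A) : (m * n).l a = m.l (n.l a) := rfl

@[simp] theorem mul_r (m n : MultAlg A) (a : A) : (m * n).r a = n.r (m.r a) := rfl

@[simp] theorem incl_l (a b : A) : (incl a).l b = a * b := rfl

@[simp] theorem incl_r (a b : A) : (incl a).r b = b * a := rfl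

theorem tmul_l (m : MultAlg A) (n : MultAlg B) : (tmul m n).l = TensorProduct.map m.l n.l := rfl

theorem tmul_r (m : MultAlg A) (n : MultAlg B) : (tmul m n).r = TensorProduct.map m.r n.r := rfl

theorem ext_of_l_of_r {m n : MultAlg A} (hl : m.l = n.l) (hr : m.r = n.r) : m = n :=
  Subtype.ext (Prod.ext hl (MulOpposite.unop_injective hr))

theorem ext_of_l (hA : NondegenerateProduct A) {m n : MultAlg A} (h : m.l = n.l) : m = n :=
  ext_of_l_of_r h <| LinearMap.ext fun a => hA.eq_of_mul_right fun b => by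
    rw [r_mul_eq, r_mul_eq, h]

theorem ext_of_r (hA : NondegenerateProduct A) {m n : MultAlg A} (h : m.r = n.r) : m = n :=
  ext_of_l_of_r (LinearMap.ext fun a => hA.eq_of_mul_left fun b => by
    rw [← r_mul_eq, ← r_mul_eq, h]) h

theorem incl_injective (hA : NondegenerateProduct A) :
    Function.Injective (incl : A → MultAlg A) := fun _ _ h =>
  hA.eq_of_mul_right fun c => congrArg (fun m : MultAlg A => m.l c) h

theorem incl_zero : incl (0 : A) = 0 :=
  ext_of_l_of_r (LinearMap.ext zero_mul) (LinearMap.ext mul_zero)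

theorem incl_add (a b : A) : incl (a + b) = incl a + incl b :=
  ext_of_l_of_r (LinearMap.ext (add_mul a b)) (LinearMap.ext fun c => mul_add c a b)

theorem incl_mul_eq (a : A) (m : MultAlg A) : incl a * m = incl (m.r a) :=
  ext_of_l_of_r (LinearMap.ext fun b => by simp [r_mul_eq])
    (LinearMap.ext fun b => by simp [r_mul])

theorem mul_incl_eq (a : A) (m : MultAlg A) : m * incl a = incl (m.l a) :=
  ext_of_l_of_r (LinearMap.ext fun b => by simp [l_mul])
    (LinearMap.ext fun b => by simp [r_mul_eq])

theorem incl_mul (a b : A) : incl (a * b) = incl a * incl b :=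
  (mul_incl_eq b (incl a)).symm

theorem incl_tmul (a : A) (b : B) : incl (a ⊗ₜ[ℂ] b) = tmul (incl a) (incl b) :=
  ext_of_l_of_r (TensorProduct.ext' fun x y => by simp [tmul_l])
    (TensorProduct.ext' fun x y => by simp [tmul_r])

theorem tmul_mul_tmul (m m' : MultAlg A) (n n' : MultAlg B) :
    tmul m n * tmul m' n' = tmul (m * m') (n * n') :=
  ext_of_l_of_r (TensorProduct.ext' fun x y => by simp [tmul_l])
    (TensorProduct.ext' fun x y => by simp [tmul_r])

theorem incl_mulLeft₁ (c : A) (z : A ⊗[ℂ] B) : incl (mulLeft₁ c z) = tmul (incl c) 1 * incl z :=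
  (mul_incl_eq z (tmul (incl c) 1)).symm

theorem incl_mulLeft₂ (c : B) (z : A ⊗[ℂ] B) : incl (mulLeft₂ c z) = tmul 1 (incl c) * incl z :=
  (mul_incl_eq z (tmul 1 (incl c))).symm

theorem incl_mulRight₁ (c : A) (z : A ⊗[ℂ] B) : incl (mulRight₁ c z) = incl z * tmul (incl c) 1 :=
  (incl_mul_eq z (tmul (incl c) 1)).symm

theorem incl_mulRight₂ (c : B) (z : A ⊗[ℂ] B) : incl (mulRight₂ c z) = incl z * tmul 1 (incl c) :=
  (incl_mul_eq z (tmul 1 (incl c))).symm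

theorem l_r_comm (hA : NondegenerateProduct A) (m n : MultAlg A) (a : A) :
    m.l (n.r a) = n.r (m.l a) :=
  hA.eq_of_mul_right fun b => by rw [← l_mul, r_mul_eq, r_mul_eq, l_mul]

theorem l_mulRight₁ (hAB : NondegenerateProduct (A ⊗[ℂ] B)) (m : MultAlg (A ⊗[ℂ] B)) (c : A)
    (z : A ⊗[ℂ] B) : m.l (mulRight₁ c z) = mulRight₁ c (m.l z) :=
  l_r_comm hAB m (tmul (incl c) 1) z

theorem l_mulRight₂ (hAB : NondegenerateProduct (A ⊗[ℂ] B)) (m : MultAlg (A ⊗[ℂ] B)) (c : B)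
    (z : A ⊗[ℂ] B) : m.l (mulRight₂ c z) = mulRight₂ c (m.l z) :=
  l_r_comm hAB m (tmul 1 (incl c)) z

theorem r_mulLeft₂ (hAB : NondegenerateProduct (A ⊗[ℂ] B)) (m : MultAlg (A ⊗[ℂ] B)) (c : B)
    (z : A ⊗[ℂ] B) : m.r (mulLeft₂ c z) = mulLeft₂ c (m.r z) :=
  (l_r_comm hAB (tmul 1 (incl c)) m z).symm

/-- The flip of a multiplier of `A ⊗ A`. -/
def swap (m : MultAlg (A ⊗[ℂ] A)) : MultAlg (A ⊗[ℂ] A) :=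
  transport (TensorProduct.comm ℂ A A) comm_mul m

theorem swap_l (m : MultAlg (A ⊗[ℂ] A)) : m.swap.l = flipConj m.l := rfl

theorem swap_r (m : MultAlg (A ⊗[ℂ] A)) : m.swap.r = flipConj m.r := rfl

@[simp] theorem swap_swap (m : MultAlg (A ⊗[ℂ] A)) : m.swap.swap = m :=
  ext_of_l_of_r (flipConj_flipConj m.l) (flipConj_flipConj m.r)

theorem swap_mul (m n : MultAlg (A ⊗[ℂ] A)) : (m * n).swap = m.swap * n.swap :=
  ext_of_l_of_r (LinearMap.ext fun z => by simp [swap_l, flipConj_apply])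
    (LinearMap.ext fun z => by simp [swap_r, flipConj_apply])

theorem swap_incl (z : A ⊗[ℂ] A) : (incl z).swap = incl (TensorProduct.comm ℂ A A z) :=
  ext_of_l_of_r (LinearMap.ext fun w => by simp [swap_l, flipConj_apply, comm_mul])
    (LinearMap.ext fun w => by simp [swap_r, flipConj_apply, comm_mul])

theorem swap_tmul (m n : MultAlg A) : (tmul m n).swap = tmul n m :=
  ext_of_l_of_r (TensorProduct.ext' fun x y => by simp [swap_l, tmul_l])
    (TensorProduct.ext' fun x y => by simp [swap_r, tmul_r])

end MultAlg

/-! ### The canonical maps of a weak multiplier Hopf algebra -/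

namespace WeakMultiplierHopfAlgebra

variable {A : Type*} [NonUnitalRing A] [Module ℂ A] [IsScalarTower ℂ A A] [SMulCommClass ℂ A A]

section Basic

variable (H : WeakMultiplierHopfAlgebra A)

include H in
theorem nondegenerate₂ : NondegenerateProduct (A ⊗[ℂ] A) := H.nondegenerate.tensor H.nondegenerate

theorem Δ_l_tmul (a x y : A) : (H.Δ a).l (x ⊗ₜ y) = mulRight₁ x (H.T₁ (a ⊗ₜ y)) := by
  refine incl_injective H.nondegenerate₂ ?_
  rw [incl_mulRight₁, H.T₁_spec, ← mul_incl_eq, incl_tmul, mul_assoc, tmul_mul_tmul, one_mul,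
    mul_one]

theorem Δ_r_tmul (a x y : A) : (H.Δ a).r (x ⊗ₜ y) = mulLeft₂ y (H.T₂ (x ⊗ₜ a)) := by
  refine incl_injective H.nondegenerate₂ ?_
  rw [incl_mulLeft₂, H.T₂_spec, ← incl_mul_eq, incl_tmul, ← mul_assoc, tmul_mul_tmul, one_mul,
    mul_one]

theorem Δ_l_T₁ (a b c : A) : (H.Δ a).l (H.T₁ (b ⊗ₜ c)) = H.T₁ ((a * b) ⊗ₜ c) := by
  refine incl_injective H.nondegenerate₂ ?_
  rw [← mul_incl_eq, H.T₁_spec, H.T₁_spec, map_mul, mul_assoc]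

theorem Δ_r_T₂ (a b c : A) : (H.Δ c).r (H.T₂ (a ⊗ₜ b)) = H.T₂ (a ⊗ₜ (b * c)) := by
  refine incl_injective H.nondegenerate₂ ?_
  rw [← incl_mul_eq, H.T₂_spec, H.T₂_spec, map_mul, mul_assoc]

theorem mulRight₂_T₁ (a b c : A) : mulRight₂ c (H.T₁ (a ⊗ₜ b)) = H.T₁ (a ⊗ₜ (b * c)) := by
  refine incl_injective H.nondegenerate₂ ?_
  rw [incl_mulRight₂, H.T₁_spec, H.T₁_spec, mul_assoc, tmul_mul_tmul, one_mul, incl_mul]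

theorem mulLeft₁_T₁ (a b c : A) : mulLeft₁ c (H.T₁ (a ⊗ₜ b)) = mulRight₂ b (H.T₂ (c ⊗ₜ a)) := by
  refine incl_injective H.nondegenerate₂ ?_
  rw [incl_mulLeft₁, incl_mulRight₂, H.T₁_spec, H.T₂_spec, mul_assoc]

theorem isIdempotentElem_E_l : IsIdempotentElem (H.E.l : Module.End ℂ (A ⊗[ℂ] A)) :=
  congrArg l H.E_idempotent

theorem isIdempotentElem_E_r : IsIdempotentElem (H.E.r : Module.End ℂ (A ⊗[ℂ] A)) :=
  congrArg r H.E_idempotent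

theorem exists_T₁_eq (z : A ⊗[ℂ] A) : ∃ w, H.T₁ w = H.E.l z :=
  H.range_T₁.le (LinearMap.mem_range_self H.E.l z)

theorem exists_T₂_eq (z : A ⊗[ℂ] A) : ∃ w, H.T₂ w = H.E.r z :=
  H.range_T₂.le (LinearMap.mem_range_self H.E.r z)

theorem E_l_T₁ (z : A ⊗[ℂ] A) : H.E.l (H.T₁ z) = H.T₁ z :=
  (LinearMap.IsIdempotentElem.mem_range_iff H.isIdempotentElem_E_l).mp <|
    H.range_T₁.ge (LinearMap.mem_range_self H.T₁ z)

theorem E_r_T₂ (z : A ⊗[ℂ] A) : H.E.r (H.T₂ z) = H.T₂ z :=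
  (LinearMap.IsIdempotentElem.mem_range_iff H.isIdempotentElem_E_r).mp <|
    H.range_T₂.ge (LinearMap.mem_range_self H.T₂ z)

theorem E_mul_Δ (a : A) : H.E * H.Δ a = H.Δ a :=
  ext_of_l H.nondegenerate₂ <| TensorProduct.ext' fun x y => by
    rw [mul_l, H.Δ_l_tmul, l_mulRight₁ H.nondegenerate₂, H.E_l_T₁]

theorem Δ_mul_E (a : A) : H.Δ a * H.E = H.Δ a :=
  ext_of_r H.nondegenerate₂ <| TensorProduct.ext' fun x y => by
    rw [mul_r, H.Δ_r_tmul, r_mulLeft₂ H.nondegenerate₂, H.E_r_T₂]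

theorem Δ_l_E_l (a : A) (z : A ⊗[ℂ] A) : (H.Δ a).l (H.E.l z) = (H.Δ a).l z :=
  congrArg (fun m => m.l z) (H.Δ_mul_E a)

theorem Δ_r_E_r (a : A) (z : A ⊗[ℂ] A) : (H.Δ a).r (H.E.r z) = (H.Δ a).r z :=
  congrArg (fun m => m.r z) (H.E_mul_Δ a)

theorem leftSlice_T₁ (z : A ⊗[ℂ] A) : leftSlice H.ε (H.T₁ z) = LinearMap.mul' ℂ A z :=
  LinearMap.congr_fun (f := leftSlice H.ε ∘ₗ H.T₁) (g := LinearMap.mul' ℂ A)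
    (TensorProduct.ext' H.counit_left) z

theorem rightSlice_T₂ (z : A ⊗[ℂ] A) : rightSlice H.ε (H.T₂ z) = LinearMap.mul' ℂ A z :=
  LinearMap.congr_fun (f := rightSlice H.ε ∘ₗ H.T₂) (g := LinearMap.mul' ℂ A)
    (TensorProduct.ext' H.counit_right) z

theorem hasFullLeftLeg_flipConj_T₂ : HasFullLeftLeg (flipConj H.T₂) := by
  intro V hV
  apply H.full_right
  rintro _ ⟨w, rfl⟩
  obtain ⟨u, hu⟩ := hV (LinearMap.mem_range_self _ (TensorProduct.comm ℂ A A w))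
  rw [flipConj_apply, TensorProduct.comm_comm] at hu
  exact ⟨TensorProduct.comm ℂ _ _ u, (LinearMap.lTensor_comm V.subtype u).trans <| by
    rw [LinearMap.rTensor, hu, TensorProduct.comm_comm]⟩

theorem eq_zero_of_lTensor_T₂ {V : Type*} [AddCommGroup V] [Module ℂ V] (f : A →ₗ[ℂ] V)
    (hf : ∀ a c, f.lTensor A (H.T₂ (a ⊗ₜ c)) = 0) : f = 0 :=
  H.hasFullLeftLeg_flipConj_T₂.eq_zero f fun a c => by
    rw [flipConj_tmul, LinearMap.rTensor_comm, hf, map_zero]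

end Basic

/-- `K` has the opposite coproduct of `H`. -/
def IsCop (H K : WeakMultiplierHopfAlgebra A) : Prop := ∀ a, K.Δ a = (H.Δ a).swap

namespace IsCop

variable {H K : WeakMultiplierHopfAlgebra A} (h : IsCop H K)
include h

theorem symm : IsCop K H := fun a => by rw [h a, swap_swap]

theorem swap_E_l_T₁ (z : A ⊗[ℂ] A) : H.E.swap.l (K.T₁ z) = K.T₁ z := by
  refine LinearMap.congr_fun (f := H.E.swap.l ∘ₗ K.T₁) (TensorProduct.ext' fun a b => ?_) z
  refine incl_injective K.nondegenerate₂ ?_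
  rw [LinearMap.comp_apply, ← mul_incl_eq, K.T₁_spec, ← mul_assoc, h a, ← swap_mul, H.E_mul_Δ]

theorem swap_E_r_T₂ (z : A ⊗[ℂ] A) : H.E.swap.r (K.T₂ z) = K.T₂ z := by
  refine LinearMap.congr_fun (f := H.E.swap.r ∘ₗ K.T₂) (TensorProduct.ext' fun a b => ?_) z
  refine incl_injective K.nondegenerate₂ ?_
  rw [LinearMap.comp_apply, ← incl_mul_eq, K.T₂_spec, mul_assoc, h b, ← swap_mul, H.Δ_mul_E]

theorem swap_E_mul_E : H.E.swap * K.E = K.E :=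
  ext_of_l K.nondegenerate₂ <| LinearMap.ext fun z => by
    obtain ⟨w, hw⟩ := K.exists_T₁_eq z
    rw [mul_l, ← hw, h.swap_E_l_T₁]

theorem E_mul_swap_E : K.E * H.E.swap = K.E :=
  ext_of_r K.nondegenerate₂ <| LinearMap.ext fun z => by
    obtain ⟨w, hw⟩ := K.exists_T₂_eq z
    rw [mul_r, ← hw, h.swap_E_r_T₂]

theorem E_eq : K.E = H.E.swap := by
  rw [← h.E_mul_swap_E, ← swap_swap K.E, ← swap_mul, h.symm.swap_E_mul_E]

theorem incl_comm_T₂ (y a : A) :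
    incl (TensorProduct.comm ℂ A A (K.T₂ (y ⊗ₜ a))) = tmul 1 (incl y) * H.Δ a := by
  rw [← swap_incl, K.T₂_spec, swap_mul, swap_tmul, ← h.symm a]

/-- Both sides are `(1 ⊗ c)Δᶜᵒᵖ(a)(1 ⊗ b)`. -/
theorem mulLeft₂_T₁ (a b c : A) :
    mulLeft₂ c (K.T₁ (a ⊗ₜ b)) = mulRight₂ b (TensorProduct.comm ℂ A A (H.T₂ (c ⊗ₜ a))) := by
  refine incl_injective K.nondegenerate₂ ?_
  rw [incl_mulLeft₂, incl_mulRight₂, K.T₁_spec, h.symm.incl_comm_T₂, mul_assoc]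

theorem ε_eq : K.ε = H.ε := by
  have hK (c a : A) : rightSlice K.ε (H.T₂ (c ⊗ₜ a)) = c * a := by
    refine H.nondegenerate.eq_of_mul_right fun b => ?_
    have := congrArg (leftSlice K.ε) (h.mulLeft₂_T₁ a b c)
    rw [leftSlice_lTensor, leftSlice_lTensor, K.leftSlice_T₁, leftSlice_comm] at this
    simpa [mul_assoc] using this.symm
  rw [← sub_eq_zero]
  refine H.eq_zero_of_lTensor_T₂ _ fun c a => (TensorProduct.rid ℂ A).injective ?_
  rw [LinearMap.lTensor_sub, LinearMap.sub_apply, map_sub, map_zero, sub_eq_zero]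
  exact (hK c a).trans (H.counit_right c a).symm

end IsCop

end WeakMultiplierHopfAlgebra

/-! ### Commutation of the canonical maps on neighbouring legs -/

section Flip

variable {k A : Type*} [CommRing k] [AddCommGroup A] [Module k A]

theorem range_flipConj (f : Module.End k (A ⊗[k] A)) : LinearMap.range (flipConj f) =
    (LinearMap.range f).map (TensorProduct.comm k A A).toLinearMap := by
  rw [flipConj, LinearEquiv.conj_apply, LinearEquiv.range_comp, LinearMap.range_comp]

theorem ker_flipConj (f : Module.End k (A ⊗[k] A)) : LinearMap.ker (flipConj f) =
    (LinearMap.ker f).map (TensorProduct.comm k A A).toLinearMap := by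
  rw [flipConj, LinearEquiv.conj_apply, LinearMap.ker_comp, LinearEquiv.ker_comp]
  exact (Submodule.map_equiv_eq_comap_symm _ _).symm

theorem IsGenInv.flipConj {T P G R : Module.End k (A ⊗[k] A)} (h : IsGenInv T P G R) :
    IsGenInv (flipConj T) (flipConj P) (flipConj G) (flipConj R) :=
  h.map ((TensorProduct.comm k A A).conjAlgEquiv k)

theorem onLegs₁₂_tmul_eq (f : Module.End k (A ⊗[k] A)) (x : A) (z : A ⊗[k] A) :
    onLegs₁₂ A f (x ⊗ₜ z) =
      TensorProduct.assoc k A A A ((f ∘ₗ TensorProduct.mk k A A x).rTensor A z) := by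
  refine LinearMap.congr_fun (?_ : onLegs₁₂ A f ∘ₗ TensorProduct.mk k A _ x =
    (TensorProduct.assoc k A A A).toLinearMap ∘ₗ (f ∘ₗ TensorProduct.mk k A A x).rTensor A) z
  ext; simp

theorem lTensor_assoc_tmul (g : Module.End k (A ⊗[k] A)) (y : A) (z : A ⊗[k] A) :
    g.lTensor A (TensorProduct.assoc k A A A (z ⊗ₜ y)) =
      (g ∘ₗ (TensorProduct.mk k A A).flip y).lTensor A z := by
  refine LinearMap.congr_fun (?_ : g.lTensor A ∘ₗ (TensorProduct.assoc k A A A).toLinearMap ∘ₗ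
    (TensorProduct.mk k _ A).flip y = (g ∘ₗ (TensorProduct.mk k A A).flip y).lTensor A) z
  ext; simp

end Flip

theorem delta₁₃Right_flipConj {A : Type*} [AddCommGroup A] [Module ℂ A]
    (T : Module.End ℂ (A ⊗[ℂ] A)) (w : A ⊗[ℂ] (A ⊗[ℂ] A)) :
    delta₁₃Right (flipConj T) w = (TensorProduct.assoc ℂ A A A).symm (reverseLegs ℂ A
      (delta₁₃Left T ((TensorProduct.assoc ℂ A A A).symm (reverseLegs ℂ A w)))) := by
  refine LinearMap.congr_fun (?_ : delta₁₃Right (flipConj T) =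
    (TensorProduct.assoc ℂ A A A).symm.toLinearMap ∘ₗ (reverseLegs ℂ A).toLinearMap ∘ₗ
      delta₁₃Left T ∘ₗ (TensorProduct.assoc ℂ A A A).symm.toLinearMap ∘ₗ
        (reverseLegs ℂ A).toLinearMap) w
  ext a b c
  simp only [TensorProduct.AlgebraTensorModule.curry_apply, TensorProduct.curry_apply,
    LinearMap.restrictScalars_self, LinearMap.comp_apply, LinearEquiv.coe_coe, reverseLegs_tmul,
    LinearEquiv.symm_apply_apply, delta₁₃Right, delta₁₃Left, TensorProduct.comm_tmul,
    TensorProduct.leftComm_tmul, TensorProduct.rightComm_tmul, TensorProduct.map_tmul,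
    LinearMap.id_apply, flipConj_tmul]
  induction T (c ⊗ₜ a) with
  | zero => simp
  | add z z' hz hz' =>
    simp only [TensorProduct.tmul_add, TensorProduct.add_tmul, map_add, hz, hz']
  | tmul p q => simp [reverseLegs_tmul]

namespace MultAlg

variable {A : Type*} [NonUnitalRing A] [Module ℂ A] [IsScalarTower ℂ A A] [SMulCommClass ℂ A A]

theorem leg₁₂_l (m : MultAlg (A ⊗[ℂ] A)) : (leg₁₂ m).l = onLegs₁₂ A m.l := rfl

theorem leg₁₂_r (m : MultAlg (A ⊗[ℂ] A)) : (leg₁₂ m).r = onLegs₁₂ A m.r := rfl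

theorem leg₁₂_mul_tmul_one_tmul_one_incl (m : MultAlg (A ⊗[ℂ] A)) (y : A) :
    leg₁₂ m * tmul 1 (tmul 1 (incl y)) = tmul 1 (tmul 1 (incl y)) * leg₁₂ m :=
  ext_of_l_of_r
    (LinearMap.ext fun z => onLegs₁₂_lTensor_lTensor m.l (LinearMap.mulLeft ℂ y) z)
    (LinearMap.ext fun z => (onLegs₁₂_lTensor_lTensor m.r (LinearMap.mulRight ℂ y) z).symm)

end MultAlg

namespace WeakMultiplierHopfAlgebra

variable {A : Type*} [NonUnitalRing A] [Module ℂ A] [IsScalarTower ℂ A A] [SMulCommClass ℂ A A]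

section Basic

variable (H : WeakMultiplierHopfAlgebra A)

theorem legComm_T₂_T₁ : LegComm H.T₂ H.T₁ :=
  LegComm.of_apply fun x a y => by
    rw [onLegs₁₂_tmul_eq, lTensor_assoc_tmul]
    exact H.coassoc a y x

theorem legComm_E_r_E_l : LegComm H.E.r H.E.l :=
  LinearMap.ext fun w =>
    (l_r_comm (H.nondegenerate.tensor H.nondegenerate₂) (leg₂₃ H.E) (leg₁₂ H.E) w).symm

theorem legComm_E_r_T₁ : LegComm H.E.r H.T₁ := by
  obtain ⟨Φ, hΦ, -, -, hΦE⟩ := H.id_tensor_Δ_E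
  have hΦT₁ (z : A ⊗[ℂ] A) (y : A) :
      incl (H.T₁.lTensor A (TensorProduct.assoc ℂ A A A (z ⊗ₜ y))) =
        Φ (incl z) * tmul 1 (tmul 1 (incl y)) := by
    induction z with
    | zero => simp [incl_zero]
    | add z z' hz hz' => simp only [TensorProduct.add_tmul, map_add, incl_add, hz, hz', add_mul]
    | tmul u v =>
      rw [hΦ, tmul_mul_tmul, ← H.T₁_spec, mul_one, ← incl_tmul, TensorProduct.assoc_tmul,
        LinearMap.lTensor_tmul]
  refine LegComm.of_apply fun x a y => ?_
  apply incl_injective (H.nondegenerate.tensor H.nondegenerate₂)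
  symm
  calc incl (H.T₁.lTensor A (TensorProduct.assoc ℂ A A A (H.E.r (x ⊗ₜ a) ⊗ₜ y)))
      = Φ (incl (x ⊗ₜ a)) * Φ H.E * tmul 1 (tmul 1 (incl y)) := by
        rw [hΦT₁, ← incl_mul_eq, map_mul]
    _ = tmul (incl x) (H.Δ a) * leg₁₂ H.E * tmul 1 (tmul 1 (incl y)) := by
        rw [hΦE, hΦ, leg₂₃, ← mul_assoc, tmul_mul_tmul, mul_one, H.Δ_mul_E]
    _ = incl (x ⊗ₜ H.T₁ (a ⊗ₜ y)) * leg₁₂ H.E := by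
        rw [mul_assoc, leg₁₂_mul_tmul_one_tmul_one_incl, ← mul_assoc, tmul_mul_tmul, mul_one,
          ← H.T₁_spec, ← incl_tmul]
    _ = incl (onLegs₁₂ A H.E.r (x ⊗ₜ H.T₁ (a ⊗ₜ y))) := by rw [incl_mul_eq, leg₁₂_r]

theorem isCanonicalMap_T₁ : IsCanonicalMap H.T₁ H.E.l H.G₁ where
  full := H.full_left
  idem := H.isIdempotentElem_E_l
  range_eq := H.range_T₁
  spec := H.G₁_spec
  ker_eq := H.ker_T₁

theorem map_flipConj_G₂_delta₁₃Right (w : A ⊗[ℂ] (A ⊗[ℂ] A)) :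
    TensorProduct.map (flipConj H.G₂) LinearMap.id (delta₁₃Right (flipConj H.T₂) w) =
      delta₁₃Right (flipConj H.T₂) ((flipConj H.E.r).lTensor A w) := by
  have hG₂ (u : (A ⊗[ℂ] A) ⊗[ℂ] A) : H.G₂.lTensor A (delta₁₃Left H.T₂ u) =
      delta₁₃Left H.T₂ (H.E.r.rTensor A u) := by
    refine LinearMap.congr_fun (?_ : H.G₂.lTensor A ∘ₗ delta₁₃Left H.T₂ =
      delta₁₃Left H.T₂ ∘ₗ H.E.r.rTensor A) u
    ext a b c
    exact H.G₂_spec a b c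
  rw [delta₁₃Right_flipConj, delta₁₃Right_flipConj, reverseLegs_lTensor, flipConj_flipConj,
    onLegs₁₂_apply, LinearEquiv.symm_apply_apply, ← hG₂, reverseLegs_lTensor, onLegs₁₂_apply,
    LinearEquiv.symm_apply_apply, LinearMap.rTensor]

theorem isCanonicalMap_flipConj_T₂ :
    IsCanonicalMap (flipConj H.T₂) (flipConj H.E.r) (flipConj H.G₂) where
  full := H.hasFullLeftLeg_flipConj_T₂
  idem := H.isIdempotentElem_E_r.map ((TensorProduct.comm ℂ A A).conjAlgEquiv ℂ)
  range_eq := by rw [range_flipConj, range_flipConj, H.range_T₂]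
  spec a b c := H.map_flipConj_G₂_delta₁₃Right (a ⊗ₜ (b ⊗ₜ c))
  ker_eq := by
    have : LinearMap.id - flipConj H.G₂ = flipConj (LinearMap.id - H.G₂) := by simp [flipConj]
    rw [this, range_flipConj, ker_flipConj, H.ker_T₂]

theorem legComm_G₁ {f : Module.End ℂ (A ⊗[ℂ] A)} (hf : LegComm f H.T₁) : LegComm f H.G₁ :=
  H.isCanonicalMap_T₁.legComm_proj hf

theorem legComm_G₂ {g : Module.End ℂ (A ⊗[ℂ] A)} (hg : LegComm H.T₂ g) : LegComm H.G₂ g :=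
  (H.isCanonicalMap_flipConj_T₂.legComm_proj hg.flipConj).of_flipConj

theorem exists_isGenInv_T₂ : ∃ R, IsGenInv H.T₂ H.E.r H.G₂ R := by
  obtain ⟨R, hR⟩ := H.isCanonicalMap_flipConj_T₂.exists_isGenInv
  exact ⟨flipConj R, by simpa only [flipConj_flipConj] using hR.flipConj⟩

variable {H} in
theorem legComm_genInv_T₁ {R₂ : Module.End ℂ (A ⊗[ℂ] A)} (hR₂ : IsGenInv H.T₂ H.E.r H.G₂ R₂) :
    LegComm R₂ H.T₁ :=
  .genInv_left hR₂ H.legComm_T₂_T₁ H.legComm_E_r_T₁ (H.legComm_G₂ H.legComm_T₂_T₁)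

end Basic

namespace IsCop

variable {H K : WeakMultiplierHopfAlgebra A} (h : IsCop H K)
include h

theorem legComm_E_l_flipConj_T₂ : LegComm H.E.l (flipConj K.T₂) := by
  obtain ⟨Φ, hΦ, -, hΦE, -⟩ := H.id_tensor_Δ_E
  have hΦT₂ (z : A ⊗[ℂ] A) (y : A) :
      incl ((flipConj K.T₂).lTensor A (TensorProduct.assoc ℂ A A A (z ⊗ₜ y))) =
        tmul 1 (tmul 1 (incl y)) * Φ (incl z) := by
    induction z with
    | zero => simp [incl_zero]
    | add z z' hz hz' => simp only [TensorProduct.add_tmul, map_add, incl_add, hz, hz', mul_add]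
    | tmul u v =>
      rw [hΦ, tmul_mul_tmul, ← h.incl_comm_T₂, one_mul, ← incl_tmul, TensorProduct.assoc_tmul,
        LinearMap.lTensor_tmul, flipConj_tmul]
  refine LegComm.of_apply fun x a y => ?_
  apply incl_injective (H.nondegenerate.tensor H.nondegenerate₂)
  symm
  calc incl ((flipConj K.T₂).lTensor A (TensorProduct.assoc ℂ A A A (H.E.l (x ⊗ₜ a) ⊗ₜ y)))
      = tmul 1 (tmul 1 (incl y)) * (Φ H.E * Φ (incl (x ⊗ₜ a))) := by
        rw [hΦT₂, ← mul_incl_eq, map_mul]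
    _ = tmul 1 (tmul 1 (incl y)) * (leg₁₂ H.E * tmul (incl x) (H.Δ a)) := by
        rw [hΦE, hΦ, leg₂₃, mul_assoc, tmul_mul_tmul, one_mul, H.E_mul_Δ]
    _ = leg₁₂ H.E * incl (x ⊗ₜ flipConj K.T₂ (a ⊗ₜ y)) := by
        rw [← mul_assoc, ← leg₁₂_mul_tmul_one_tmul_one_incl, mul_assoc, tmul_mul_tmul, one_mul,
          ← h.incl_comm_T₂, ← incl_tmul, flipConj_tmul]
    _ = incl (onLegs₁₂ A H.E.l (x ⊗ₜ flipConj K.T₂ (a ⊗ₜ y))) := by rw [mul_incl_eq, leg₁₂_l]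

theorem legComm_T₂_E_l : LegComm H.T₂ H.E.l := by
  have := h.symm.legComm_E_l_flipConj_T₂.flipConj
  rwa [flipConj_flipConj, h.E_eq, swap_l, flipConj_flipConj] at this

variable {R₁ R₂ : Module.End ℂ (A ⊗[ℂ] A)}

theorem legComm_T₂_genInv (hR₁ : IsGenInv H.T₁ H.E.l H.G₁ R₁) : LegComm H.T₂ R₁ :=
  .genInv_right hR₁ H.legComm_T₂_T₁ h.legComm_T₂_E_l (H.legComm_G₁ H.legComm_T₂_T₁)

theorem legComm_genInv_genInv (hR₁ : IsGenInv H.T₁ H.E.l H.G₁ R₁)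
    (hR₂ : IsGenInv H.T₂ H.E.r H.G₂ R₂) : LegComm R₂ R₁ :=
  .genInv_left hR₂ (h.legComm_T₂_genInv hR₁)
    (.genInv_right hR₁ H.legComm_E_r_T₁ H.legComm_E_r_E_l (H.legComm_G₁ H.legComm_E_r_T₁))
    (H.legComm_G₂ (h.legComm_T₂_genInv hR₁))

end IsCop

end WeakMultiplierHopfAlgebra

/-! ### Contractions of operators on two legs -/

section Contractions

variable {k V W : Type*} [CommSemiring k] [AddCommMonoid V] [Module k V] [AddCommMonoid W]
  [Module k W]

theorem apply_rightSlice (η : V →ₗ[k] k) (ω : W →ₗ[k] k) (z : V ⊗[k] W) :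
    η (rightSlice ω z) = ω (leftSlice η z) := by
  refine LinearMap.congr_fun (?_ : η ∘ₗ rightSlice ω = ω ∘ₗ leftSlice η) z
  ext; simp [mul_comm]

/-- The slice `ω ↦ (ι ⊗ ω)(t)` of a fixed tensor, as a linear map of the functional. -/
def rightSliceHom (t : V ⊗[k] W) : (W →ₗ[k] k) →ₗ[k] V :=
  (TensorProduct.rid k V).toLinearMap ∘ₗ (LinearMap.lTensorHom V).flip t

/-- The operator `w ↦ (ω ⊗ ι)(g(w ⊗ y))` obtained from an operator `g` on two legs. -/
def leftContract (ω : V →ₗ[k] k) (g : Module.End k (V ⊗[k] W)) (y : W) : V →ₗ[k] W :=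
  leftSlice ω ∘ₗ g ∘ₗ (TensorProduct.mk k V W).flip y

/-- The operator `w ↦ (ι ⊗ ω)(f(x ⊗ w))` obtained from an operator `f` on two legs. -/
def rightContract (ω : W →ₗ[k] k) (f : Module.End k (V ⊗[k] W)) (x : V) : W →ₗ[k] V :=
  rightSlice ω ∘ₗ f ∘ₗ TensorProduct.mk k V W x

@[simp] theorem leftContract_apply (ω : V →ₗ[k] k) (g : Module.End k (V ⊗[k] W)) (y : W) (w : V) :
    leftContract ω g y w = leftSlice ω (g (w ⊗ₜ y)) := rfl

@[simp] theorem rightContract_apply (ω : W →ₗ[k] k) (f : Module.End k (V ⊗[k] W)) (x : V) (w : W) :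
    rightContract ω f x w = rightSlice ω (f (x ⊗ₜ w)) := rfl

end Contractions

section LegContractions

variable {k A M : Type*} [CommRing k] [AddCommGroup A] [Module k A] [AddCommGroup M] [Module k M]

theorem leftContract_flipConj (ω : A →ₗ[k] k) (f : Module.End k (A ⊗[k] A)) (x : A) :
    leftContract ω (flipConj f) x = rightContract ω f x :=
  LinearMap.ext fun w => leftSlice_comm ω (f (x ⊗ₜ w))

theorem lTensor_leftSlice_assoc (ω : A →ₗ[k] k) (z : A ⊗[k] A) (m : M) :
    (leftSlice ω).lTensor A (TensorProduct.assoc k A A M (z ⊗ₜ m)) = rightSlice ω z ⊗ₜ m := by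
  refine LinearMap.congr_fun (?_ : (leftSlice ω).lTensor A ∘ₗ
    (TensorProduct.assoc k A A M).toLinearMap ∘ₗ (TensorProduct.mk k _ M).flip m =
      (TensorProduct.mk k A M).flip m ∘ₗ rightSlice ω) z
  ext; simp [TensorProduct.smul_tmul']

theorem lTensor_leftSlice_onLegs₁₂ (ω : A →ₗ[k] k) (f : Module.End k (A ⊗[k] A)) (x : A)
    (z : A ⊗[k] M) :
    (leftSlice ω).lTensor A (onLegs₁₂ M f (x ⊗ₜ z)) = (rightContract ω f x).rTensor M z := by
  refine LinearMap.congr_fun (?_ : (leftSlice ω).lTensor A ∘ₗ onLegs₁₂ M f ∘ₗ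
    TensorProduct.mk k A _ x = (rightContract ω f x).rTensor M) z
  ext a m
  simp [lTensor_leftSlice_assoc]

theorem LegComm.rTensor_rightContract {f g : Module.End k (A ⊗[k] A)} (h : LegComm f g)
    (ω : A →ₗ[k] k) (x u y : A) :
    (rightContract ω f x).rTensor A (g (u ⊗ₜ y)) =
      (leftContract ω g y).lTensor A (f (x ⊗ₜ u)) := by
  rw [← lTensor_leftSlice_onLegs₁₂, ← LinearMap.lTensor_tmul, h.apply, onLegs₁₂_tmul,
    lTensor_assoc_tmul, ← LinearMap.lTensor_comp_apply]
  rfl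

end LegContractions

theorem IsCanonicalMap.rTensor_leftContract {A : Type*} [AddCommGroup A] [Module ℂ A]
    {T P G : Module.End ℂ (A ⊗[ℂ] A)} (h : IsCanonicalMap T P G) (ω : A →ₗ[ℂ] ℂ) (a b c : A) :
    (leftContract ω G b).rTensor A (T (a ⊗ₜ c)) =
      (leftSlice ω ∘ₗ T ∘ₗ TensorProduct.mk ℂ A A a).lTensor A (P (b ⊗ₜ c)) := by
  refine eq_of_rightSlice fun η => ?_
  have hslice (z : A ⊗[ℂ] A) : leftSlice ω (slice₁₃ T η (a ⊗ₜ z)) =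
      rightSlice η ((leftSlice ω ∘ₗ T ∘ₗ TensorProduct.mk ℂ A A a).lTensor A z) := by
    refine LinearMap.congr_fun (?_ : leftSlice ω ∘ₗ slice₁₃ T η ∘ₗ TensorProduct.mk ℂ A _ a =
      rightSlice η ∘ₗ (leftSlice ω ∘ₗ T ∘ₗ TensorProduct.mk ℂ A A a).lTensor A) z
    ext
    simp [apply_rightSlice]
  rw [rightSlice_rTensor, leftContract_apply, ← slice₁₃_tmul, h.proj_slice₁₃,
    LinearMap.lTensor_tmul, hslice]

namespace WeakMultiplierHopfAlgebra

variable {A : Type*} [NonUnitalRing A] [Module ℂ A] [IsScalarTower ℂ A A] [SMulCommClass ℂ A A]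

section Basic

section

variable (H : WeakMultiplierHopfAlgebra A)

theorem leftContract_T₁ (y : A) : leftContract H.ε H.T₁ y = LinearMap.mulRight ℂ y :=
  LinearMap.ext fun a => H.counit_left a y

theorem rightContract_T₂ (x : A) : rightContract H.ε H.T₂ x = LinearMap.mulLeft ℂ x :=
  LinearMap.ext fun a => H.counit_right x a

variable {H} in
theorem mulLeft₁_of_legComm {g : Module.End ℂ (A ⊗[ℂ] A)} (hg : LegComm H.T₂ g) (x u y : A) :
    mulLeft₁ x (g (u ⊗ₜ y)) = (leftContract H.ε g y).lTensor A (H.T₂ (x ⊗ₜ u)) := by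
  rw [← hg.rTensor_rightContract, rightContract_T₂]

variable {H} in
theorem mulRight₂_of_legComm {f : Module.End ℂ (A ⊗[ℂ] A)} (hf : LegComm f H.T₁) (x u y : A) :
    mulRight₂ y (f (x ⊗ₜ u)) = (rightContract H.ε f x).rTensor A (H.T₁ (u ⊗ₜ y)) := by
  rw [hf.rTensor_rightContract, leftContract_T₁]

/-- In Sweedler notation, `∑ ε_s(a₍₁₎)b ⊗ a₍₂₎c = (1 ⊗ a)E(b ⊗ c)`. -/
theorem rTensor_leftContract_G₁ (a b c : A) :
    (leftContract H.ε H.G₁ b).rTensor A (H.T₁ (a ⊗ₜ c)) = mulLeft₂ a (H.E.l (b ⊗ₜ c)) := by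
  rw [H.isCanonicalMap_T₁.rTensor_leftContract]
  congr 2
  exact LinearMap.ext (H.counit_left a)

/-- In Sweedler notation, `∑ ac₍₁₎ ⊗ bε_t(c₍₂₎) = (a ⊗ b)E(c ⊗ 1)`. -/
theorem lTensor_rightContract_G₂ (a b c : A) :
    (rightContract H.ε H.G₂ b).lTensor A (H.T₂ (a ⊗ₜ c)) = mulRight₁ c (H.E.r (a ⊗ₜ b)) := by
  have hc : leftSlice H.ε ∘ₗ flipConj H.T₂ ∘ₗ TensorProduct.mk ℂ A A c = LinearMap.mulRight ℂ c :=
    LinearMap.ext fun a => (leftSlice_comm _ _).trans (H.counit_right a c)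
  have := H.isCanonicalMap_flipConj_T₂.rTensor_leftContract H.ε c b a
  rw [leftContract_flipConj, hc, flipConj_tmul, flipConj_tmul, LinearMap.rTensor_comm,
    ← comm_mulRight₁] at this
  exact (TensorProduct.comm ℂ A A).injective this

/-- Both sides are `x ε_s(v) y`. -/
theorem mul_leftSlice_G₁ (x v y : A) :
    x * leftSlice H.ε (H.G₁ (v ⊗ₜ y)) = rightSlice H.ε (H.E.r (x ⊗ₜ v)) * y := by
  suffices hs : LinearMap.mulLeft ℂ x ∘ₗ leftContract H.ε H.G₁ y -
      LinearMap.mulRight ℂ y ∘ₗ rightContract H.ε H.E.r x = 0 from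
    sub_eq_zero.mp (LinearMap.congr_fun hs v)
  refine HasFullLeftLeg.eq_zero H.full_left _ fun a c => ?_
  rw [LinearMap.rTensor_sub, LinearMap.sub_apply, sub_eq_zero, LinearMap.rTensor_comp_apply,
    LinearMap.rTensor_comp_apply, H.rTensor_leftContract_G₁,
    ← mulRight₂_of_legComm H.legComm_E_r_T₁, ← mul_tmul_eq, r_mul_eq, tmul_mul_eq]

theorem rightSlice_Δ_r (a : A) (z : A ⊗[ℂ] A) :
    rightSlice H.ε ((H.Δ a).r z) = rightSlice H.ε (H.E.r z) * a := by
  obtain ⟨w, hw⟩ := H.exists_T₂_eq z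
  rw [← H.Δ_r_E_r, ← hw]
  refine LinearMap.congr_fun (?_ : rightSlice H.ε ∘ₗ (H.Δ a).r ∘ₗ H.T₂ =
    LinearMap.mulRight ℂ a ∘ₗ rightSlice H.ε ∘ₗ H.T₂) w
  ext b c
  simp [H.Δ_r_T₂, H.rightSlice_T₂, mul_assoc]

theorem leftSlice_Δ_l (a : A) (z : A ⊗[ℂ] A) :
    leftSlice H.ε ((H.Δ a).l z) = a * leftSlice H.ε (H.E.l z) := by
  obtain ⟨w, hw⟩ := H.exists_T₁_eq z
  rw [← H.Δ_l_E_l, ← hw]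
  refine LinearMap.congr_fun (?_ : leftSlice H.ε ∘ₗ (H.Δ a).l ∘ₗ H.T₁ =
    LinearMap.mulLeft ℂ a ∘ₗ leftSlice H.ε ∘ₗ H.T₁) w
  ext b c
  simp [H.Δ_l_T₁, H.leftSlice_T₁, mul_assoc]

theorem mul_leftSlice_G₁_eq_rightSlice (x w b : A) :
    x * leftSlice H.ε (H.G₁ (w ⊗ₜ b)) = rightSlice H.ε (mulLeft₂ w (H.T₂ (x ⊗ₜ b))) := by
  rw [H.mul_leftSlice_G₁, ← H.rightSlice_Δ_r, H.Δ_r_tmul]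

theorem T₁_mulRight₂ (c : A) (z : A ⊗[ℂ] A) : H.T₁ (mulRight₂ c z) = mulRight₂ c (H.T₁ z) := by
  refine LinearMap.congr_fun (?_ : H.T₁ ∘ₗ mulRight₂ c = mulRight₂ c ∘ₗ H.T₁) z
  exact TensorProduct.ext' fun a b => (H.mulRight₂_T₁ a b c).symm

theorem T₁_mulLeft₁ (p : A) (z : A ⊗[ℂ] A) : H.T₁ (mulLeft₁ p z) = (H.Δ p).l (H.T₁ z) := by
  refine LinearMap.congr_fun (?_ : H.T₁ ∘ₗ mulLeft₁ p = (H.Δ p).l ∘ₗ H.T₁) z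
  exact TensorProduct.ext' fun a b => (H.Δ_l_T₁ p a b).symm

theorem G₁_mulRight₂ (c : A) (z : A ⊗[ℂ] A) : H.G₁ (mulRight₂ c z) = mulRight₂ c (H.G₁ z) := by
  refine LinearMap.congr_fun (f := H.G₁ ∘ₗ mulRight₂ c) (g := mulRight₂ c ∘ₗ H.G₁)
    (H.isCanonicalMap_T₁.ext_slice₁₃ fun ω w => ?_) z
  have hslice (w : A ⊗[ℂ] (A ⊗[ℂ] A)) :
      mulRight₂ c (slice₁₃ H.T₁ ω w) = slice₁₃ H.T₁ ω ((mulRight₁ c).lTensor A w) := by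
    refine LinearMap.congr_fun (?_ : mulRight₂ c ∘ₗ slice₁₃ H.T₁ ω =
      slice₁₃ H.T₁ ω ∘ₗ (mulRight₁ c).lTensor A) w
    ext
    simp
  rw [LinearMap.comp_apply, LinearMap.comp_apply, hslice, H.isCanonicalMap_T₁.proj_slice₁₃,
    H.isCanonicalMap_T₁.proj_slice₁₃, hslice, ← LinearMap.lTensor_comp_apply,
    ← LinearMap.lTensor_comp_apply]
  congr 3
  exact LinearMap.ext fun u => l_mulRight₁ H.nondegenerate₂ H.E c u

end

variable {H : WeakMultiplierHopfAlgebra A} {R₁ : Module.End ℂ (A ⊗[ℂ] A)}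
  (hR₁ : IsGenInv H.T₁ H.E.l H.G₁ R₁)
include hR₁

theorem genInv_mulRight₂ (c : A) (z : A ⊗[ℂ] A) : R₁ (mulRight₂ c z) = mulRight₂ c (R₁ z) :=
  LinearMap.congr_fun (hR₁.commute (X := (mulRight₂ c : Module.End ℂ (A ⊗[ℂ] A)))
    (LinearMap.ext fun u => (H.T₁_mulRight₂ c u).symm)
    (LinearMap.ext fun u => (l_mulRight₂ H.nondegenerate₂ H.E c u).symm)
    (LinearMap.ext fun u => (H.G₁_mulRight₂ c u).symm)).eq.symm z

/-- The elements in question are the products `S(a)b`. -/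
theorem leftSlice_genInv_surjective : Function.Surjective (leftSlice H.ε ∘ₗ R₁) := by
  set V := LinearMap.range (leftSlice H.ε ∘ₗ R₁)
  have hG₁ (b : A) : V.mkQ ∘ₗ leftContract H.ε H.G₁ b = 0 := by
    ext w
    rw [LinearMap.comp_apply, leftContract_apply, ← hR₁.apply_left]
    exact (Submodule.Quotient.mk_eq_zero V).mpr ⟨H.T₁ (w ⊗ₜ b), rfl⟩
  have hE (d : A) : V.mkQ.rTensor A ∘ₗ mulLeft₂ d ∘ₗ H.E.l = 0 :=
    TensorProduct.ext' fun b c => by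
      rw [LinearMap.comp_apply, LinearMap.comp_apply, ← H.rTensor_leftContract_G₁,
        ← LinearMap.rTensor_comp_apply, hG₁, LinearMap.rTensor_zero]
      rfl
  have hV : V.mkQ = 0 := by
    refine HasFullLeftLeg.eq_zero H.full_left _ fun a c => ?_
    refine H.nondegenerate.eq_of_mulLeft₂ fun d => ?_
    have := LinearMap.congr_fun (hE d) (H.T₁ (a ⊗ₜ c))
    rw [LinearMap.comp_apply, LinearMap.comp_apply, H.E_l_T₁, ← lTensor_rTensor_apply] at this
    rw [this, map_zero, LinearMap.zero_apply]
  exact LinearMap.range_eq_top.mp (V.ker_mkQ.symm.trans (by rw [hV, LinearMap.ker_zero]))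

end Basic

end WeakMultiplierHopfAlgebra

/-! ### The two descriptions of the source map, the target map and the antipode -/

namespace WeakMultiplierHopfAlgebra

variable {A : Type*} [NonUnitalRing A] [Module ℂ A] [IsScalarTower ℂ A A] [SMulCommClass ℂ A A]

/-- Elements are separated by the functionals `ε(w ·)`, hence `w ↦ ε_s(w)b` factors through
`w ↦ ε(w ·)`. -/
theorem lTensor_leftContract_G₁_congr (H : WeakMultiplierHopfAlgebra A) (b : A) {z z' : A ⊗[ℂ] A}
    (hz : ∀ y, rightSlice H.ε (mulRight₂ y z) = rightSlice H.ε (mulRight₂ y z')) :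
    (leftContract H.ε H.G₁ b).lTensor A z = (leftContract H.ε H.G₁ b).lTensor A z' := by
  let e : A →ₗ[ℂ] A →ₗ[ℂ] ℂ := (LinearMap.mul ℂ A).compr₂ H.ε
  have he : e.lTensor A z = e.lTensor A z' := by
    refine eq_of_lTensor (fun y : A => LinearMap.applyₗ (R := ℂ) (M₂ := ℂ) y)
      (fun v hv => LinearMap.ext hv) fun y => (TensorProduct.rid ℂ A).injective ?_
    rw [← LinearMap.lTensor_comp_apply, ← LinearMap.lTensor_comp_apply]
    have := hz y
    rwa [rightSlice_lTensor, rightSlice_lTensor] at this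
  refine H.nondegenerate.eq_of_mulLeft₂ fun x => ?_
  have hfactor : LinearMap.mulLeft ℂ x ∘ₗ leftContract H.ε H.G₁ b =
      rightSliceHom (H.T₂ (x ⊗ₜ b)) ∘ₗ e := by
    ext w
    refine (H.mul_leftSlice_G₁_eq_rightSlice x w b).trans ?_
    rw [rightSlice_lTensor]
    rfl
  rw [← LinearMap.lTensor_comp_apply, ← LinearMap.lTensor_comp_apply, hfactor,
    LinearMap.lTensor_comp_apply, LinearMap.lTensor_comp_apply, he]

namespace IsCop

variable {H K : WeakMultiplierHopfAlgebra A} (h : IsCop H K)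
include h

/-- Both sides are `u ε_t(v) y`. -/
theorem rightSlice_G₂_mul (u v y : A) :
    rightSlice H.ε (H.G₂ (u ⊗ₜ v)) * y = u * leftSlice H.ε (H.E.l (v ⊗ₜ y)) := by
  suffices hs : LinearMap.mulRight ℂ y ∘ₗ rightContract H.ε H.G₂ u -
      LinearMap.mulLeft ℂ u ∘ₗ leftContract H.ε H.E.l y = 0 from
    sub_eq_zero.mp (LinearMap.congr_fun hs v)
  refine H.eq_zero_of_lTensor_T₂ _ fun a c => ?_
  rw [LinearMap.lTensor_sub, LinearMap.sub_apply, sub_eq_zero, LinearMap.lTensor_comp_apply,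
    LinearMap.lTensor_comp_apply, H.lTensor_rightContract_G₂,
    ← mulLeft₁_of_legComm h.legComm_T₂_E_l, lTensor_rTensor_apply, ← mul_tmul_eq, r_mul_eq,
    tmul_mul_eq, lTensor_rTensor_apply]

/-- Both sides are `x S(a) y`. -/
theorem rightSlice_genInv_mul {R₁ R₂ : Module.End ℂ (A ⊗[ℂ] A)}
    (hR₁ : IsGenInv H.T₁ H.E.l H.G₁ R₁) (hR₂ : IsGenInv H.T₂ H.E.r H.G₂ R₂) (x a y : A) :
    rightSlice H.ε (R₂ (x ⊗ₜ a)) * y = x * leftSlice H.ε (R₁ (a ⊗ₜ y)) := by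
  let μ : A ⊗[ℂ] (A ⊗[ℂ] A) →ₗ[ℂ] A := LinearMap.mul' ℂ A ∘ₗ (LinearMap.mul' ℂ A).lTensor A
  have hμ (z : A ⊗[ℂ] A) (q : A) :
      μ (TensorProduct.assoc ℂ A A A (z ⊗ₜ q)) = LinearMap.mul' ℂ A z * q := by
    refine LinearMap.congr_fun (?_ : μ ∘ₗ (TensorProduct.assoc ℂ A A A).toLinearMap ∘ₗ
      (TensorProduct.mk ℂ _ A).flip q = LinearMap.mulRight ℂ q ∘ₗ LinearMap.mul' ℂ A) z
    ext
    simp [μ, mul_assoc]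
  have hG₂ (z : A ⊗[ℂ] A) : rightSlice H.ε (H.G₂ z) * y =
      μ (R₁.lTensor A (TensorProduct.assoc ℂ A A A (z ⊗ₜ y))) := by
    refine LinearMap.congr_fun (?_ : LinearMap.mulRight ℂ y ∘ₗ rightSlice H.ε ∘ₗ H.G₂ =
      μ ∘ₗ R₁.lTensor A ∘ₗ (TensorProduct.assoc ℂ A A A).toLinearMap ∘ₗ
        (TensorProduct.mk ℂ _ A).flip y) z
    refine TensorProduct.ext' fun u v => (h.rightSlice_G₂_mul u v y).trans ?_
    rw [← hR₁.apply_right, H.leftSlice_T₁]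
    rfl
  have hG₁ (z : A ⊗[ℂ] A) :
      x * leftSlice H.ε (H.G₁ z) = μ (onLegs₁₂ A R₂ (x ⊗ₜ z)) := by
    refine LinearMap.congr_fun (?_ : LinearMap.mulLeft ℂ x ∘ₗ leftSlice H.ε ∘ₗ H.G₁ =
      μ ∘ₗ onLegs₁₂ A R₂ ∘ₗ TensorProduct.mk ℂ A _ x) z
    refine TensorProduct.ext' fun u v => (H.mul_leftSlice_G₁ x u v).trans ?_
    rw [← hR₂.apply_right, H.rightSlice_T₂, ← hμ, ← onLegs₁₂_tmul]
    rfl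
  rw [← hR₂.proj_left, hG₂, ← hR₁.proj_left, hG₁, ← LinearMap.lTensor_tmul,
    (h.legComm_genInv_genInv hR₁ hR₂).apply, onLegs₁₂_tmul]

theorem mulLeft₁_comm_T₂ (x w b : A) :
    mulLeft₁ x (TensorProduct.comm ℂ A A (K.T₂ (w ⊗ₜ b))) = (H.Δ b).r (x ⊗ₜ w) := by
  refine incl_injective H.nondegenerate₂ ?_
  rw [incl_mulLeft₁, h.incl_comm_T₂, ← incl_mul_eq, incl_tmul, ← mul_assoc, tmul_mul_tmul,
    one_mul, mul_one]

theorem leftSlice_G₁ (z : A ⊗[ℂ] A) : leftSlice H.ε (H.G₁ z) = leftSlice H.ε (K.T₂ z) := by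
  refine LinearMap.congr_fun (f := leftSlice H.ε ∘ₗ H.G₁) (g := leftSlice H.ε ∘ₗ K.T₂)
    (TensorProduct.ext' fun w b => H.nondegenerate.eq_of_mul_left fun x => ?_) z
  rw [LinearMap.comp_apply, LinearMap.comp_apply, H.mul_leftSlice_G₁, ← H.rightSlice_Δ_r,
    ← h.mulLeft₁_comm_T₂, rightSlice_rTensor, rightSlice_comm, LinearMap.mulLeft_apply]

theorem rightSlice_mulRight₂_T₂_mul (q c y x : A) :
    rightSlice H.ε (mulRight₂ y (H.T₂ (q ⊗ₜ c))) * x =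
      q * (c * leftSlice K.ε (K.E.l (y ⊗ₜ x))) := by
  have hT₂ : mulRight₁ x (mulRight₂ y (H.T₂ (q ⊗ₜ c))) = mulLeft₁ q ((H.Δ c).l (x ⊗ₜ y)) := by
    refine incl_injective H.nondegenerate₂ ?_
    rw [← mul_tmul_eq, incl_mul, H.T₂_spec, incl_mulLeft₁, ← mul_incl_eq, mul_assoc]
  have := congrArg (rightSlice H.ε) hT₂
  rw [rightSlice_rTensor, rightSlice_rTensor] at this
  rw [← K.leftSlice_Δ_l, h c, swap_l, flipConj_tmul, leftSlice_comm, h.ε_eq]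
  exact this

theorem G₁_mulLeft₁ (p : A) (z : A ⊗[ℂ] A) : H.G₁ (mulLeft₁ p z) = mulLeft₁ p (H.G₁ z) := by
  refine LinearMap.congr_fun (f := H.G₁ ∘ₗ mulLeft₁ p) (g := mulLeft₁ p ∘ₗ H.G₁)
    (TensorProduct.ext' fun a b => H.nondegenerate.eq_of_mulLeft₁ fun q => ?_) z
  have hG₁ := mulLeft₁_of_legComm (H.legComm_G₁ H.legComm_T₂_T₁)
  rw [LinearMap.comp_apply, LinearMap.comp_apply, LinearMap.rTensor_tmul, LinearMap.mulLeft_apply,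
    mulLeft₁_mulLeft₁, hG₁, hG₁]
  refine H.lTensor_leftContract_G₁_congr b fun y => H.nondegenerate.eq_of_mul_right fun x => ?_
  simp only [h.rightSlice_mulRight₂_T₂_mul, mul_assoc]

variable {R₁ R₁' : Module.End ℂ (A ⊗[ℂ] A)} (hR₁ : IsGenInv H.T₁ H.E.l H.G₁ R₁)
include hR₁

theorem genInv_Δ_l (p : A) (z : A ⊗[ℂ] A) : R₁ ((H.Δ p).l z) = mulLeft₁ p (R₁ z) := by
  rw [← H.Δ_l_E_l, ← hR₁.apply_right, ← H.T₁_mulLeft₁, hR₁.apply_left, h.G₁_mulLeft₁,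
    hR₁.proj_left]

/-- `R₁(ab ⊗ c) = ∑ (p ⊗ 1)R₁(b ⊗ q)` for `R₁(a ⊗ c) = ∑ p ⊗ q`. -/
theorem genInv_mul_tmul (a b c : A) : R₁ ((a * b) ⊗ₜ c) =
    TensorProduct.lift ((LinearMap.rTensorHom A ∘ₗ LinearMap.mul ℂ A).compl₂
      (R₁ ∘ₗ TensorProduct.mk ℂ A A b)) (R₁ (a ⊗ₜ c)) := by
  have hT₁ : TensorProduct.lift ((LinearMap.rTensorHom A ∘ₗ LinearMap.mul ℂ A).compl₂
      (R₁ ∘ₗ TensorProduct.mk ℂ A A b)) = R₁ ∘ₗ mulRight₁ b ∘ₗ H.T₁ :=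
    TensorProduct.ext' fun p q => by
      rw [LinearMap.comp_apply, LinearMap.comp_apply, ← H.Δ_l_tmul, h.genInv_Δ_l hR₁]
      rfl
  rw [hT₁, LinearMap.comp_apply, LinearMap.comp_apply, hR₁.apply_right,
    ← l_mulRight₁ H.nondegenerate₂, hR₁.proj_right, LinearMap.rTensor_tmul,
    LinearMap.mulRight_apply]

/-- Both sides are `S(Sᶜᵒᵖ(a)b)y`. -/
theorem leftSlice_genInv_leftSlice_genInv (hR₁' : IsGenInv K.T₁ K.E.l K.G₁ R₁') (a b y : A) :
    leftSlice H.ε (R₁ (leftSlice K.ε (R₁' (a ⊗ₜ b)) ⊗ₜ y)) =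
      leftSlice H.ε (R₁ (b ⊗ₜ (a * y))) := by
  have hT₁ (z : A ⊗[ℂ] A) :
      leftSlice H.ε (R₁ (mulRight₂ y (TensorProduct.comm ℂ A A (K.T₁ z)))) =
        leftSlice H.ε (R₁ (leftSlice K.ε (K.G₁ z) ⊗ₜ y)) := by
    refine LinearMap.congr_fun (?_ : leftSlice H.ε ∘ₗ R₁ ∘ₗ mulRight₂ y ∘ₗ
      (TensorProduct.comm ℂ A A).toLinearMap ∘ₗ K.T₁ =
        leftSlice H.ε ∘ₗ R₁ ∘ₗ (TensorProduct.mk ℂ A A).flip y ∘ₗ leftSlice K.ε ∘ₗ K.G₁) z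
    refine TensorProduct.ext' fun p q => ?_
    have hΔ : mulRight₂ y (TensorProduct.comm ℂ A A (K.T₁ (p ⊗ₜ q))) = (H.Δ p).l (q ⊗ₜ y) := by
      rw [← comm_mulRight₁, ← K.Δ_l_tmul, h p, swap_l, flipConj_tmul, TensorProduct.comm_comm]
    simp only [LinearMap.comp_apply, LinearEquiv.coe_coe, LinearMap.flip_apply,
      TensorProduct.mk_apply]
    rw [hΔ, h.genInv_Δ_l hR₁, mulLeft₁_of_legComm (h.legComm_T₂_genInv hR₁), leftSlice_lTensor,
      h.symm.leftSlice_G₁, h.ε_eq, leftContract_apply]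
  rw [← hR₁'.proj_left, ← hT₁, hR₁'.apply_right, h.E_eq, swap_l, flipConj_tmul,
    TensorProduct.comm_comm, ← l_mulRight₂ H.nondegenerate₂, hR₁.proj_right,
    LinearMap.lTensor_tmul, LinearMap.mulRight_apply]

end IsCop

end WeakMultiplierHopfAlgebra

section Intertwining

variable {k A : Type*} [Field k] [NonUnitalRing A] [Module k A] {σ σ' : A →ₗ[k] A →ₗ[k] A}
  {S S' : A →ₗ[k] A}

theorem map_mul_of_intertwine (hA : NondegenerateProduct A)
    (hσ : ∀ a b y, σ a (b * y) = σ a b * y) (h : ∀ a b y, σ (σ' a b) y = σ b (a * y))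
    (hS : ∀ c y, S c * y = σ c y) (hS' : ∀ c y, S' c * y = σ' c y)
    (hinv : Function.LeftInverse S' S) (a b : A) : S (a * b) = S b * S a := by
  have hmul (c y : A) : S c * y = S (S' y * c) :=
    hA.eq_of_mul_right fun w => by rw [hS, hS, hS', h, hσ]
  exact hA.eq_of_mul_right fun y => by
    rw [mul_assoc, hmul, hmul a, hmul b, hinv, mul_assoc]

variable [IsScalarTower k A A]

theorem lift_flip_mul_of_intertwine (hσ : ∀ a b y, σ a (b * y) = σ a b * y)
    (h : ∀ a b y, σ (σ' a b) y = σ b (a * y)) (z : A ⊗[k] A) (y : A) :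
    TensorProduct.lift σ.flip z * y = σ (TensorProduct.lift σ' z) y := by
  refine LinearMap.congr_fun (?_ : LinearMap.mulRight k y ∘ₗ TensorProduct.lift σ.flip =
    σ.flip y ∘ₗ TensorProduct.lift σ') z
  ext a b
  simp [h, hσ]

theorem exists_mul_eq_of_intertwine (hσ : ∀ a b y, σ a (b * y) = σ a b * y)
    (h : ∀ a b y, σ (σ' a b) y = σ b (a * y))
    (hσ' : Function.Surjective (TensorProduct.lift σ')) :
    ∃ S : A →ₗ[k] A, ∀ c y, S c * y = σ c y := by
  obtain ⟨s, hs⟩ := (TensorProduct.lift σ').exists_rightInverse_of_surjective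
    (LinearMap.range_eq_top.mpr hσ')
  refine ⟨TensorProduct.lift σ.flip ∘ₗ s, fun c y => ?_⟩
  rw [LinearMap.comp_apply, lift_flip_mul_of_intertwine hσ h]
  exact congrArg (σ · y) (LinearMap.congr_fun hs c)

theorem leftInverse_of_intertwine (hA : NondegenerateProduct A)
    (hσ : ∀ a b y, σ a (b * y) = σ a b * y) (hσ' : ∀ a b y, σ' a (b * y) = σ' a b * y)
    (h : ∀ a b y, σ (σ' a b) y = σ b (a * y)) (h' : ∀ a b y, σ' (σ a b) y = σ' b (a * y))
    (hs : Function.Surjective (TensorProduct.lift σ'))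
    (hS : ∀ c y, S c * y = σ c y) (hS' : ∀ c y, S' c * y = σ' c y) :
    Function.LeftInverse S' S := by
  intro c
  obtain ⟨z, rfl⟩ := hs c
  have hSz : S (TensorProduct.lift σ' z) = TensorProduct.lift σ.flip z :=
    hA.eq_of_mul_right fun y => by rw [hS, lift_flip_mul_of_intertwine hσ h]
  refine hA.eq_of_mul_right fun y => ?_
  rw [hSz, hS']
  refine LinearMap.congr_fun (?_ : σ'.flip y ∘ₗ TensorProduct.lift σ.flip =
    LinearMap.mulRight k y ∘ₗ TensorProduct.lift σ') z
  ext a b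
  simp [h', hσ']

end Intertwining

/-! ### Local units -/

theorem IsUnitalAction.lift_surjective {A V : Type*} [NonUnitalRing A] [Module ℂ A]
    [AddCommGroup V] [Module ℂ V] {act : A →ₗ[ℂ] V →ₗ[ℂ] V} (hu : IsUnitalAction act) :
    Function.Surjective (TensorProduct.lift act) := by
  rw [← LinearMap.range_eq_top, eq_top_iff, ← hu, Submodule.span_le]
  rintro _ ⟨⟨a, v⟩, rfl⟩
  exact ⟨a ⊗ₜ v, TensorProduct.lift.tmul a v⟩

theorem IdempotentAlgebra.mul'_surjective {A : Type*} [NonUnitalRing A] [Module ℂ A]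
    [IsScalarTower ℂ A A] [SMulCommClass ℂ A A] (hA : IdempotentAlgebra A) :
    Function.Surjective (LinearMap.mul' ℂ A) :=
  IsUnitalAction.lift_surjective (act := LinearMap.mul ℂ A) hA

theorem IsUnitalAction.exists_finset_act_eq {A V : Type*} [NonUnitalRing A] [Module ℂ A]
    [AddCommGroup V] [Module ℂ V] {act : A →ₗ[ℂ] V →ₗ[ℂ] V} (hu : IsUnitalAction act)
    (h : IsLeftAction act) (v : V) :
    ∃ s : Finset A, ∀ e, (∀ a ∈ s, e * a = a) → act e v = v := by
  classical
  have hv : v ∈ Submodule.span ℂ (Set.range fun p : A × V => act p.1 p.2) :=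
    hu.ge Submodule.mem_top
  induction hv using Submodule.span_induction with
  | mem x hx =>
    obtain ⟨⟨a, y⟩, rfl⟩ := hx
    exact ⟨{a}, fun e he => by rw [← h, he a (Finset.mem_singleton_self a)]⟩
  | zero => exact ⟨∅, fun e _ => map_zero _⟩
  | add x y _ _ hx hy =>
    obtain ⟨s, hs⟩ := hx
    obtain ⟨t, ht⟩ := hy
    refine ⟨s ∪ t, fun e he => ?_⟩
    rw [map_add, hs e fun a ha => he a (Finset.mem_union_left t ha),
      ht e fun a ha => he a (Finset.mem_union_right s ha)]
  | smul c x _ hx =>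
    obtain ⟨s, hs⟩ := hx
    exact ⟨s, fun e he => by rw [map_smul, hs e he]⟩

section LocalUnits

variable {A : Type*} [NonUnitalRing A] [Module ℂ A] [IsScalarTower ℂ A A]

/-- The left ideal `Aa`; without a unit in `A` it need not contain `a`. -/
def leftIdeal (a : A) : Submodule ℂ A := LinearMap.range (LinearMap.mulRight ℂ a)

/-- The map `p ↦ (x + Aa ↦ f(p ⊗ x) + Aa)` induced by a right `A`-linear map `f : A ⊗ A → A`. -/
def quotientContract (f : A ⊗[ℂ] A →ₗ[ℂ] A) (hf : ∀ c z, f (mulRight₂ c z) = f z * c) (a : A) :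
    A →ₗ[ℂ] (A ⧸ leftIdeal a) →ₗ[ℂ] (A ⧸ leftIdeal a) where
  toFun p := (leftIdeal a).mapQ (leftIdeal a) (TensorProduct.curry f p) <| by
    rintro _ ⟨x, rfl⟩
    exact ⟨f (p ⊗ₜ x), (hf a (p ⊗ₜ x)).symm⟩
  map_add' p q := by ext x; simp
  map_smul' c p := by ext x; simp

theorem lift_quotientContract {f : A ⊗[ℂ] A →ₗ[ℂ] A} (hf : ∀ c z, f (mulRight₂ c z) = f z * c)
    (a : A) (z : A ⊗[ℂ] A) :
    TensorProduct.lift (quotientContract f hf a) ((leftIdeal a).mkQ.lTensor A z) =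
      (leftIdeal a).mkQ (f z) :=
  LinearMap.congr_fun (f := TensorProduct.lift (quotientContract f hf a) ∘ₗ
    (leftIdeal a).mkQ.lTensor A) (g := (leftIdeal a).mkQ ∘ₗ f)
    (TensorProduct.ext' fun _ _ => rfl) z

theorem exists_left_unit (hA : ∀ a : A, a ∈ leftIdeal a) (s : Finset A) :
    ∃ e : A, ∀ a ∈ s, e * a = a := by
  classical
  induction s using Finset.induction_on with
  | empty => exact ⟨0, by simp⟩
  | insert a s _ ih =>
    obtain ⟨e, he⟩ := ih
    obtain ⟨f, hf⟩ := hA (a - e * a)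
    rw [LinearMap.mulRight_apply] at hf
    -- the unit `e` of `s` is corrected on `a`: `1 - (f + e - fe) = (1 - f)(1 - e)`
    refine ⟨f + e - f * e, fun b hb => ?_⟩
    rcases Finset.mem_insert.1 hb with rfl | hb
    · rw [sub_mul, add_mul, mul_assoc, add_sub_right_comm, ← mul_sub, hf, sub_add_cancel]
    · rw [sub_mul, add_mul, mul_assoc, he b hb, add_sub_cancel_left]

theorem IsUnitalAction.isNondegenerateAction {V : Type*} [AddCommGroup V] [Module ℂ V]
    {act : A →ₗ[ℂ] V →ₗ[ℂ] V} (hu : IsUnitalAction act) (h : IsLeftAction act)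
    (hA : ∀ a : A, a ∈ leftIdeal a) : IsNondegenerateAction act := by
  intro v hv
  obtain ⟨s, hs⟩ := hu.exists_finset_act_eq h v
  obtain ⟨e, he⟩ := exists_left_unit hA s
  rw [← hs e he, hv]

end LocalUnits

namespace WeakMultiplierHopfAlgebra

variable {A : Type*} [NonUnitalRing A] [Module ℂ A] [IsScalarTower ℂ A A] [SMulCommClass ℂ A A]

section

variable (H : WeakMultiplierHopfAlgebra A)

theorem mkQ_lTensor_T₁ (a w : A) : (leftIdeal a).mkQ.lTensor A (H.T₁ (w ⊗ₜ a)) = 0 := by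
  refine H.nondegenerate.eq_of_mulLeft₁ fun q => ?_
  have ha : (leftIdeal a).mkQ ∘ₗ LinearMap.mulRight ℂ a = 0 := by
    ext x
    exact (Submodule.Quotient.mk_eq_zero _).mpr ⟨x, rfl⟩
  rw [← lTensor_rTensor_apply, H.mulLeft₁_T₁, ← LinearMap.lTensor_comp_apply, ha,
    LinearMap.lTensor_zero, LinearMap.zero_apply, map_zero]

theorem mkQ_leftContract_G₁ (a : A) : (leftIdeal a).mkQ ∘ₗ leftContract H.ε H.G₁ a = 0 := by
  obtain ⟨R₁, hR₁⟩ := H.isCanonicalMap_T₁.exists_isGenInv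
  have hf (c : A) (z : A ⊗[ℂ] A) :
      (leftSlice H.ε ∘ₗ R₁) (mulRight₂ c z) = (leftSlice H.ε ∘ₗ R₁) z * c := by
    rw [LinearMap.comp_apply, H.genInv_mulRight₂ hR₁, leftSlice_lTensor]
    rfl
  ext w
  rw [LinearMap.comp_apply, leftContract_apply, ← hR₁.apply_left, ← LinearMap.comp_apply (g := R₁),
    ← lift_quotientContract hf, H.mkQ_lTensor_T₁, map_zero, LinearMap.zero_apply]

theorem mkQ_rTensor_E (a y : A) : (leftIdeal a).mkQ.rTensor A (H.E.l (a ⊗ₜ y)) = 0 := by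
  refine H.nondegenerate.eq_of_mulLeft₂ fun x => ?_
  rw [lTensor_rTensor_apply, ← H.rTensor_leftContract_G₁, ← LinearMap.rTensor_comp_apply,
    H.mkQ_leftContract_G₁, LinearMap.rTensor_zero, LinearMap.zero_apply, map_zero]

end

namespace IsCop

variable {H K : WeakMultiplierHopfAlgebra A} (h : IsCop H K)
include h

/-- `E(uv ⊗ y) = ∑ u₍₁₎v ⊗ ε_t(u₍₂₎)y`. -/
theorem rTensor_leftContract_E (y : A) (z : A ⊗[ℂ] A) :
    (leftContract H.ε H.E.l y).rTensor A (K.T₁ z) =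
      TensorProduct.comm ℂ A A (H.E.l (LinearMap.mul' ℂ A z ⊗ₜ y)) := by
  refine LinearMap.congr_fun (?_ : (leftContract H.ε H.E.l y).rTensor A ∘ₗ K.T₁ =
    (TensorProduct.comm ℂ A A).toLinearMap ∘ₗ H.E.l ∘ₗ
      (TensorProduct.mk ℂ A A).flip y ∘ₗ LinearMap.mul' ℂ A) z
  refine TensorProduct.ext' fun u v => H.nondegenerate.eq_of_mulLeft₂ fun x => ?_
  have huv : (u * v) ⊗ₜ[ℂ] y = mulRight₁ v (u ⊗ₜ y) := rfl
  have hcomm : LinearMap.mulRight ℂ v ∘ₗ LinearMap.mulLeft ℂ x =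
      LinearMap.mulLeft ℂ x ∘ₗ LinearMap.mulRight ℂ v :=
    LinearMap.ext fun w => mul_assoc x w v
  simp only [LinearMap.comp_apply, LinearEquiv.coe_coe, LinearMap.flip_apply,
    TensorProduct.mk_apply, LinearMap.mul'_apply]
  rw [lTensor_rTensor_apply, h.mulLeft₂_T₁, ← lTensor_rTensor_apply, LinearMap.rTensor_comm,
    ← mulLeft₁_of_legComm h.legComm_T₂_E_l, huv, l_mulRight₁ H.nondegenerate₂, comm_mulRight₁,
    comm_mulLeft₁, ← LinearMap.lTensor_comp_apply, ← LinearMap.lTensor_comp_apply,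
    hcomm]

theorem counit_mul_eq_zero {p : A} (hp : ∀ y, leftSlice H.ε (H.E.l (p ⊗ₜ y)) = 0) (a : A) :
    H.ε (a * p) = 0 := by
  have hT₁ : rightSlice H.ε (K.T₁ (a ⊗ₜ p)) = 0 := H.nondegenerate.1 _ fun y => by
    have hΔ := H.leftSlice_Δ_l a (p ⊗ₜ y)
    rwa [hp, mul_zero, h.symm a, swap_l, flipConj_tmul, K.Δ_l_tmul, leftSlice_comm,
      rightSlice_rTensor] at hΔ
  rw [← K.counit_left a p, h.ε_eq]
  exact (apply_rightSlice H.ε H.ε (K.T₁ (a ⊗ₜ p))).symm.trans (by rw [hT₁, map_zero])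

theorem leftSlice_E_eq_zero {p : A} (hp : ∀ y, leftSlice H.ε (H.E.l (p ⊗ₜ y)) = 0) (c : A) :
    leftSlice K.ε (K.E.l (p ⊗ₜ c)) = 0 := by
  have hε : H.ε ∘ₗ LinearMap.mulRight ℂ p = 0 := LinearMap.ext (h.counit_mul_eq_zero hp)
  have hT₁ (a : A) : rightSlice H.ε (H.T₁ (a ⊗ₜ p)) = 0 := H.nondegenerate.2 _ fun x => by
    rw [← LinearMap.mulLeft_apply (R := ℂ), ← rightSlice_rTensor, H.mulLeft₁_T₁,
      rightSlice_lTensor, hε, rightSlice, LinearMap.lTensor_zero, LinearMap.comp_zero,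
      LinearMap.zero_apply]
  refine H.nondegenerate.2 _ fun a => ?_
  rw [← K.leftSlice_Δ_l, h a, swap_l, flipConj_tmul, H.Δ_l_tmul, leftSlice_comm, h.ε_eq,
    rightSlice_rTensor, hT₁, map_zero]

/-- Writing `a = ∑ uv`, we have `a = ∑ ε_t'(u₍₁₎v) u₍₂₎` for the target map `ε_t'` of the
co-opposite; modulo `Aa` in the second leg this vanishes, because so does `E(a ⊗ y)` modulo `Aa`
in the first. -/
theorem mem_leftIdeal (a : A) : a ∈ leftIdeal a := by
  obtain ⟨z, hz⟩ := H.idempotent.mul'_surjective a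
  have hf (c : A) (w : A ⊗[ℂ] A) :
      (leftSlice K.ε ∘ₗ K.E.l) (mulRight₂ c w) = (leftSlice K.ε ∘ₗ K.E.l) w * c := by
    rw [LinearMap.comp_apply, l_mulRight₂ K.nondegenerate₂, leftSlice_lTensor]
    rfl
  have ha : (leftSlice K.ε ∘ₗ K.E.l) (K.T₁ z) = a := by
    rw [LinearMap.comp_apply, K.E_l_T₁, K.leftSlice_T₁, hz]
  have hE (y : A) :
      (leftContract H.ε H.E.l y).rTensor _ ((leftIdeal a).mkQ.lTensor A (K.T₁ z)) = 0 := by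
    rw [← lTensor_rTensor_apply, h.rTensor_leftContract_E, hz, LinearMap.lTensor_comm,
      H.mkQ_rTensor_E, map_zero]
  rw [← (leftIdeal a).ker_mkQ, LinearMap.mem_ker, ← ha, ← lift_quotientContract hf, ha]
  refine lift_eq_zero_of_rightSlice _ fun χ => ?_
  have hp := h.leftSlice_E_eq_zero (p := rightSlice χ ((leftIdeal a).mkQ.lTensor A (K.T₁ z)))
    fun y => by rw [← leftContract_apply, ← rightSlice_rTensor, hE, map_zero]
  ext x
  exact congrArg (leftIdeal a).mkQ (hp x)

end IsCop

end WeakMultiplierHopfAlgebra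

/-! ### The antipode and the target map -/

namespace MultAlg

variable {A V : Type*} [NonUnitalRing A] [Module ℂ A] [IsScalarTower ℂ A A] [SMulCommClass ℂ A A]
  [AddCommGroup V] [Module ℂ V]

/-- The linear map `V → M(A)` whose left and right parts are given linear families of maps. For a
non-degenerate product, the compatibility of the two parts is the only multiplier identity that
has to be checked. -/
def ofCompat (hA : NondegenerateProduct A) (L L' : V →ₗ[ℂ] Module.End ℂ A)
    (h : ∀ v x y, L' v x * y = x * L v y) : V →ₗ[ℂ] MultAlg A where
  toFun v := mk (L v) (L' v)
    (fun x y => hA.eq_of_mul_left fun z => by rw [← h, ← mul_assoc, ← mul_assoc, h])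
    (fun x y => hA.eq_of_mul_right fun z => by rw [h, mul_assoc, mul_assoc, h])
    (h v)
  map_add' v w := ext_of_l hA (map_add L v w)
  map_smul' c v := ext_of_l hA (map_smul L c v)

end MultAlg

namespace WeakMultiplierHopfAlgebra

variable {A : Type*} [NonUnitalRing A] [Module ℂ A] [IsScalarTower ℂ A A] [SMulCommClass ℂ A A]
  {H K : WeakMultiplierHopfAlgebra A} {R₁ R₁' : Module.End ℂ (A ⊗[ℂ] A)}

theorem leftSlice_genInv_mul (hR₁ : IsGenInv H.T₁ H.E.l H.G₁ R₁) (a b y : A) :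
    leftSlice H.ε (R₁ (a ⊗ₜ (b * y))) = leftSlice H.ε (R₁ (a ⊗ₜ b)) * y :=
  (congrArg (leftSlice H.ε) (genInv_mulRight₂ hR₁ y (a ⊗ₜ b))).trans (leftSlice_lTensor _ _ _)

theorem leftSlice_E_l_eq (hR₁ : IsGenInv H.T₁ H.E.l H.G₁ R₁) (z : A ⊗[ℂ] A) :
    leftSlice H.ε (H.E.l z) = LinearMap.mul' ℂ A (R₁ z) := by
  rw [← hR₁.apply_right, H.leftSlice_T₁]

/-- The antipode `S` of `H` together with the generalized inverses `R₁`, `R₁'` of the canonical maps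
`T₁` of `H` and of its co-opposite `K` from which it and its inverse are obtained:
`S(c)y = (ε ⊗ ι)R₁(c ⊗ y)` and `S⁻¹(c)y = (ε ⊗ ι)R₁'(c ⊗ y)`. -/
structure IsAntipodePair (H K : WeakMultiplierHopfAlgebra A) (R₁ R₁' : Module.End ℂ (A ⊗[ℂ] A))
    (S : A ≃ₗ[ℂ] A) : Prop where
  isCop : IsCop H K
  genInv : IsGenInv H.T₁ H.E.l H.G₁ R₁
  genInv_cop : IsGenInv K.T₁ K.E.l K.G₁ R₁'
  apply_mul : ∀ c y, S c * y = leftSlice H.ε (R₁ (c ⊗ₜ y))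
  symm_apply_mul : ∀ c y, S.symm c * y = leftSlice K.ε (R₁' (c ⊗ₜ y))
  map_mul : ∀ a b, S (a * b) = S b * S a

theorem IsCop.exists_isAntipodePair (h : IsCop H K) :
    ∃ R₁ R₁' S, IsAntipodePair H K R₁ R₁' S := by
  obtain ⟨R₁, hR₁⟩ := H.isCanonicalMap_T₁.exists_isGenInv
  obtain ⟨R₁', hR₁'⟩ := K.isCanonicalMap_T₁.exists_isGenInv
  let σ : A →ₗ[ℂ] A →ₗ[ℂ] A := TensorProduct.curry (leftSlice H.ε ∘ₗ R₁)
  let σ' : A →ₗ[ℂ] A →ₗ[ℂ] A := TensorProduct.curry (leftSlice K.ε ∘ₗ R₁')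
  have hσ : ∀ a b y, σ a (b * y) = σ a b * y := leftSlice_genInv_mul hR₁
  have hσ' : ∀ a b y, σ' a (b * y) = σ' a b * y := leftSlice_genInv_mul hR₁'
  have hσσ' : ∀ a b y, σ (σ' a b) y = σ b (a * y) := h.leftSlice_genInv_leftSlice_genInv hR₁ hR₁'
  have hσ'σ : ∀ a b y, σ' (σ a b) y = σ' b (a * y) :=
    h.symm.leftSlice_genInv_leftSlice_genInv hR₁' hR₁
  have hlift (f : A ⊗[ℂ] A →ₗ[ℂ] A) : TensorProduct.lift (TensorProduct.curry f) = f :=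
    TensorProduct.ext' fun _ _ => rfl
  have hsurj : Function.Surjective (TensorProduct.lift σ) := by
    simpa only [σ, hlift] using leftSlice_genInv_surjective hR₁
  have hsurj' : Function.Surjective (TensorProduct.lift σ') := by
    simpa only [σ', hlift] using leftSlice_genInv_surjective hR₁'
  obtain ⟨S, hS⟩ := exists_mul_eq_of_intertwine hσ hσσ' hsurj'
  obtain ⟨S', hS'⟩ := exists_mul_eq_of_intertwine hσ' hσ'σ hsurj
  have hS'S := leftInverse_of_intertwine H.nondegenerate hσ hσ' hσσ' hσ'σ hsurj' hS hS'
  have hSS' := leftInverse_of_intertwine H.nondegenerate hσ' hσ hσ'σ hσσ' hsurj hS' hS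
  refine ⟨R₁, R₁', .ofLinearMap S S' (LinearMap.ext hSS') (LinearMap.ext hS'S), h, hR₁, hR₁', hS,
    hS', ?_⟩
  exact map_mul_of_intertwine H.nondegenerate hσ hσσ' hS hS' hS'S

namespace IsAntipodePair

variable {S : A ≃ₗ[ℂ] A} (h : IsAntipodePair H K R₁ R₁' S)
include h

theorem symm : IsAntipodePair K H R₁' R₁ S.symm where
  isCop := h.isCop.symm
  genInv := h.genInv_cop
  genInv_cop := h.genInv
  apply_mul := h.symm_apply_mul
  symm_apply_mul := h.apply_mul
  map_mul a b := S.injective (by simp [h.map_mul])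

/-- `(c ⊗ 1)R₁(a ⊗ b) = ∑ ca₍₁₎ ⊗ S(a₍₂₎)b`. -/
theorem mulLeft₁_genInv (a b c : A) : mulLeft₁ c (R₁ (a ⊗ₜ b)) =
    (LinearMap.mulRight ℂ b ∘ₗ S.toLinearMap).lTensor A (H.T₂ (c ⊗ₜ a)) := by
  rw [mulLeft₁_of_legComm (h.isCop.legComm_T₂_genInv h.genInv)]
  congr 2
  exact LinearMap.ext fun w => (h.apply_mul w b).symm

/-- `∑ a₍₁₎ ⊗ S(a₍₂₎)S(c) = ∑ a₍₁₎ ⊗ S(ca₍₂₎)`. -/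
theorem genInv_tmul_antipode (a c : A) : R₁ (a ⊗ₜ S c) =
    S.toLinearMap.lTensor A (TensorProduct.comm ℂ A A (K.T₂ (c ⊗ₜ a))) := by
  refine H.nondegenerate.eq_of_mulLeft₁ fun b => ?_
  have hSc : LinearMap.mulRight ℂ (S c) ∘ₗ S.toLinearMap =
      S.toLinearMap ∘ₗ LinearMap.mulLeft ℂ c :=
    LinearMap.ext fun w => (h.map_mul c w).symm
  rw [h.mulLeft₁_genInv, hSc, LinearMap.lTensor_comp_apply, ← H.Δ_r_tmul,
    ← h.isCop.mulLeft₁_comm_T₂, lTensor_rTensor_apply]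

theorem onLegs₁₂_flipConj_genInv (c : A) (z : A ⊗[ℂ] A) :
    onLegs₁₂ A (flipConj R₁) (S c ⊗ₜ z) =
      S.toLinearMap.rTensor _ (onLegs₁₂ A K.T₂ (c ⊗ₜ z)) := by
  have hassoc (w : A ⊗[ℂ] A) (y : A) :
      TensorProduct.assoc ℂ A A A (S.toLinearMap.rTensor A w ⊗ₜ y) =
        S.toLinearMap.rTensor _ (TensorProduct.assoc ℂ A A A (w ⊗ₜ y)) := by
    refine LinearMap.congr_fun (?_ : (TensorProduct.assoc ℂ A A A).toLinearMap ∘ₗ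
      (TensorProduct.mk ℂ _ A).flip y ∘ₗ S.toLinearMap.rTensor A = S.toLinearMap.rTensor _ ∘ₗ
        (TensorProduct.assoc ℂ A A A).toLinearMap ∘ₗ (TensorProduct.mk ℂ _ A).flip y) w
    ext
    simp
  refine LinearMap.congr_fun (f := onLegs₁₂ A (flipConj R₁) ∘ₗ TensorProduct.mk ℂ A _ (S c))
    (g := S.toLinearMap.rTensor _ ∘ₗ onLegs₁₂ A K.T₂ ∘ₗ TensorProduct.mk ℂ A _ c)
    (TensorProduct.ext' fun a y => ?_) z
  simp only [LinearMap.comp_apply, TensorProduct.mk_apply, onLegs₁₂_tmul, flipConj_tmul,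
    h.genInv_tmul_antipode, ← LinearMap.rTensor_comm, TensorProduct.comm_comm, hassoc]

theorem legComm_flipConj {g : Module.End ℂ (A ⊗[ℂ] A)} (hg : LegComm K.T₂ g) :
    LegComm (flipConj R₁) g := by
  refine LegComm.of_apply fun x a y => ?_
  obtain ⟨c, rfl⟩ := S.surjective x
  rw [← onLegs₁₂_tmul, h.onLegs₁₂_flipConj_genInv, h.onLegs₁₂_flipConj_genInv,
    lTensor_rTensor_apply, ← hg.apply, LinearMap.lTensor_tmul]

/-- In Sweedler notation, both sides are `∑ ba₍₁₎S(a₍₂₎)c`. -/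
theorem mul'_lTensor_antipode_mul (a b c : A) :
    LinearMap.mul' ℂ A (S.toLinearMap.lTensor A (H.T₂ (b ⊗ₜ a))) * c =
      b * leftSlice H.ε (H.E.l (a ⊗ₜ c)) := by
  have hleft : LinearMap.mul' ℂ A ∘ₗ mulLeft₁ b = LinearMap.mulLeft ℂ b ∘ₗ LinearMap.mul' ℂ A := by
    ext
    simp [mul_assoc]
  have hright : LinearMap.mul' ℂ A ∘ₗ mulRight₂ c =
      LinearMap.mulRight ℂ c ∘ₗ LinearMap.mul' ℂ A := by
    ext
    simp [mul_assoc]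
  calc LinearMap.mul' ℂ A (S.toLinearMap.lTensor A (H.T₂ (b ⊗ₜ a))) * c
      = LinearMap.mul' ℂ A (mulRight₂ c (S.toLinearMap.lTensor A (H.T₂ (b ⊗ₜ a)))) :=
        (LinearMap.congr_fun hright _).symm
    _ = LinearMap.mul' ℂ A (mulLeft₁ b (R₁ (a ⊗ₜ c))) := by
        rw [h.mulLeft₁_genInv, LinearMap.lTensor_comp_apply]
    _ = b * leftSlice H.ε (H.E.l (a ⊗ₜ c)) := by
        rw [leftSlice_E_l_eq h.genInv]
        exact LinearMap.congr_fun hleft _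

/-- The target map `ε_t`; its right part is `b ε_t(a) = ∑ ba₍₁₎S(a₍₂₎)`. -/
def targetMap : A →ₗ[ℂ] MultAlg A :=
  ofCompat H.nondegenerate (TensorProduct.curry (leftSlice H.ε ∘ₗ H.E.l))
    (TensorProduct.curry (LinearMap.mul' ℂ A ∘ₗ S.toLinearMap.lTensor A ∘ₗ H.T₂)).flip
    h.mul'_lTensor_antipode_mul

theorem targetMap_l (a b : A) : (h.targetMap a).l b = leftSlice H.ε (H.E.l (a ⊗ₜ b)) := rfl

theorem mulRight₂_genInv_T₂ {R₂ : Module.End ℂ (A ⊗[ℂ] A)}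
    (hR₂ : IsGenInv H.T₂ H.E.r H.G₂ R₂) (a b c : A) : mulRight₂ c (R₂ (a ⊗ₜ b)) =
      (LinearMap.mulLeft ℂ a ∘ₗ S.toLinearMap).rTensor A (H.T₁ (b ⊗ₜ c)) := by
  rw [mulRight₂_of_legComm (legComm_genInv_T₁ hR₂)]
  congr 2
  refine LinearMap.ext fun w => H.nondegenerate.eq_of_mul_right fun y => ?_
  rw [rightContract_apply, h.isCop.rightSlice_genInv_mul h.genInv hR₂, ← h.apply_mul, ← mul_assoc]
  rfl

end IsAntipodePair

end WeakMultiplierHopfAlgebra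

namespace RegularWeakMultiplierHopfAlgebra

open WeakMultiplierHopfAlgebra

variable {A : Type*} [NonUnitalRing A] [Module ℂ A] [IsScalarTower ℂ A A] [SMulCommClass ℂ A A]
  (H : RegularWeakMultiplierHopfAlgebra A)

theorem exists_isCop : ∃ K, IsCop H.toWeakMultiplierHopfAlgebra K := by
  obtain ⟨K, hK⟩ := H.cop
  exact ⟨K, fun a => ext_of_l_of_r (LinearMap.ext fun x => (hK a x).1)
    (LinearMap.ext fun x => (hK a x).2)⟩

variable {H} {K : WeakMultiplierHopfAlgebra A} {R₁ R₁' : Module.End ℂ (A ⊗[ℂ] A)} {S : A ≃ₗ[ℂ] A}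

theorem isAntipode (h : IsAntipodePair H.toWeakMultiplierHopfAlgebra K R₁ R₁' S) :
    H.IsAntipode S := by
  obtain ⟨R₂, hR₂⟩ := H.exists_isGenInv_T₂
  exact ⟨R₁, R₂, ⟨h.genInv.mul_right, h.genInv.mul_left, h.genInv.refl⟩,
    ⟨hR₂.mul_right, hR₂.mul_left, hR₂.refl⟩, h.mulLeft₁_genInv, h.mulRight₂_genInv_T₂ hR₂⟩

theorem T₃_tmul (h : IsCop H.toWeakMultiplierHopfAlgebra K) (a c : A) :
    H.T₃ (a ⊗ₜ c) = TensorProduct.comm ℂ A A (K.T₂ (c ⊗ₜ a)) :=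
  incl_injective H.nondegenerate₂ ((H.T₃_spec a c).trans (h.incl_comm_T₂ c a).symm)

end RegularWeakMultiplierHopfAlgebra

/-! ### Modules over multiplier algebras -/

namespace MultAlg

variable (A : Type*) [NonUnitalRing A] [Module ℂ A] [IsScalarTower ℂ A A] [SMulCommClass ℂ A A]

/-- The left part `m ↦ (a ↦ m a)` of a multiplier, as a linear map. -/
def lHom : MultAlg A →ₗ[ℂ] Module.End ℂ A where
  toFun := l
  map_add' _ _ := rfl
  map_smul' _ _ := rfl

/-- The right part `m ↦ (a ↦ a m)` of a multiplier, as a linear map. -/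
def rHom : MultAlg A →ₗ[ℂ] Module.End ℂ A where
  toFun := r
  map_add' _ _ := rfl
  map_smul' _ _ := rfl

end MultAlg

namespace IsUnitalAction

variable {A V W : Type*} [NonUnitalRing A] [Module ℂ A] [AddCommGroup V] [Module ℂ V]
  [AddCommGroup W] [Module ℂ W] {act : A →ₗ[ℂ] V →ₗ[ℂ] V} (hu : IsUnitalAction act)
include hu

theorem hom_ext {f g : V →ₗ[ℂ] W} (hfg : ∀ c x, f (act c x) = g (act c x)) : f = g :=
  LinearMap.ext_on_range (v := fun p : A × V => act p.1 p.2) hu fun p => hfg p.1 p.2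

/-- A linear section of the surjection `A ⊗ V → V` of a unital module. -/
def split : V →ₗ[ℂ] A ⊗[ℂ] V :=
  ((TensorProduct.lift act).exists_rightInverse_of_surjective
    (LinearMap.range_eq_top.mpr hu.lift_surjective)).choose

theorem lift_split (v : V) : TensorProduct.lift act (hu.split v) = v :=
  LinearMap.congr_fun ((TensorProduct.lift act).exists_rightInverse_of_surjective
    (LinearMap.range_eq_top.mpr hu.lift_surjective)).choose_spec v

theorem map_split_act {f : A ⊗[ℂ] V →ₗ[ℂ] W} (hf : ∀ z, TensorProduct.lift act z = 0 → f z = 0)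
    (c : A) (x : V) : f (hu.split (act c x)) = f (c ⊗ₜ x) := by
  rw [← sub_eq_zero, ← map_sub]
  exact hf _ (by rw [map_sub, hu.lift_split, TensorProduct.lift.tmul, sub_self])

end IsUnitalAction

section Modules

variable {A V : Type*} [NonUnitalRing A] [Module ℂ A] [IsScalarTower ℂ A A] [SMulCommClass ℂ A A]
  [AddCommGroup V] [Module ℂ V] {act : A →ₗ[ℂ] V →ₗ[ℂ] V}

theorem act_lift_rTensor_l (ha : IsLeftAction act) (m : MultAlg A) (b : A) (z : A ⊗[ℂ] V) :
    act b (TensorProduct.lift act (m.l.rTensor V z)) = act (m.r b) (TensorProduct.lift act z) := by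
  refine LinearMap.congr_fun (?_ : act b ∘ₗ TensorProduct.lift act ∘ₗ m.l.rTensor V =
    act (m.r b) ∘ₗ TensorProduct.lift act) z
  ext c x
  simp [← ha b, ← ha (m.r b), r_mul_eq]

theorem exists_isMultiplierExtension (ha : IsLeftAction act) (hu : IsUnitalAction act)
    (hn : IsNondegenerateAction act) :
    ∃ ρ, IsMultiplierExtension act ρ ∧ ∀ m c x, ρ m (act c x) = act (m.l c) x := by
  let F : MultAlg A →ₗ[ℂ] A ⊗[ℂ] V →ₗ[ℂ] V :=
    LinearMap.compRight ℂ (TensorProduct.lift act) ∘ₗ LinearMap.rTensorHom V ∘ₗ lHom A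
  have hF (m : MultAlg A) (z : A ⊗[ℂ] V) (hz : TensorProduct.lift act z = 0) : F m z = 0 :=
    hn _ fun b => (act_lift_rTensor_l ha m b z).trans (by rw [hz, map_zero])
  let L : MultAlg A →ₗ[ℂ] Module.End ℂ V := LinearMap.lcomp ℂ V hu.split ∘ₗ F
  have hL (m : MultAlg A) (c : A) (x : V) : L m (act c x) = act (m.l c) x :=
    hu.map_split_act (hF m) c x
  refine ⟨.ofLinearMap L (hu.hom_ext fun c x => hL 1 c x) fun m n => hu.hom_ext fun c x => ?_,
    fun a => hu.hom_ext fun c x => (hL _ c x).trans (ha a c x), hL⟩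
  rw [Module.End.mul_apply, hL, hL, hL, mul_l]

end Modules

section Sandwich

variable {A V : Type*} [NonUnitalRing A] [Module ℂ A] [AddCommGroup V] [Module ℂ V]
  {act : A →ₗ[ℂ] V →ₗ[ℂ] V}

variable (act) in
/-- `p ⊗ q ↦ p(g(qx))`. With `∑ p ⊗ q = ∑ a₍₁₎ ⊗ S(a₍₂₎)c`, this is the value at `cx` of the adjoint
action of `a` on the operator `g`. -/
def sandwich : Module.End ℂ V →ₗ[ℂ] V →ₗ[ℂ] A ⊗[ℂ] A →ₗ[ℂ] V :=
  LinearMap.mk₂ ℂ (fun g x => TensorProduct.lift (act.compl₂ (g ∘ₗ act.flip x)))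
    (fun _ _ _ => by ext; simp) (fun _ _ _ => by ext; simp)
    (fun _ _ _ => by ext; simp) (fun _ _ _ => by ext; simp)

@[simp] theorem sandwich_tmul (g : Module.End ℂ V) (x : V) (p q : A) :
    sandwich act g x (p ⊗ₜ q) = act p (g (act q x)) := rfl

theorem act_sandwich [SMulCommClass ℂ A A] (ha : IsLeftAction act) (g : Module.End ℂ V) (x : V)
    (b : A) (z : A ⊗[ℂ] A) : act b (sandwich act g x z) = sandwich act g x (mulLeft₁ b z) := by
  refine LinearMap.congr_fun (?_ : act b ∘ₗ sandwich act g x = sandwich act g x ∘ₗ mulLeft₁ b) z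
  ext p q
  simp [ha b]

theorem sandwich_lTensor_mulRight [IsScalarTower ℂ A A] (ha : IsLeftAction act)
    (g : Module.End ℂ V) (x : V) (c : A) (S : A →ₗ[ℂ] A) (z : A ⊗[ℂ] A) :
    sandwich act g x ((LinearMap.mulRight ℂ c ∘ₗ S).lTensor A z) =
      sandwich act g (act c x) (S.lTensor A z) := by
  refine LinearMap.congr_fun (?_ : sandwich act g x ∘ₗ (LinearMap.mulRight ℂ c ∘ₗ S).lTensor A =
    sandwich act g (act c x) ∘ₗ S.lTensor A) z
  ext p q
  simp [ha (S q)]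

theorem sandwich_lTensor (g : Module.End ℂ V) (x : V) (S : A →ₗ[ℂ] A) (z : A ⊗[ℂ] A) :
    sandwich act g x (S.lTensor A z) =
      TensorProduct.lift (act.compl₂ (g ∘ₗ act.flip x ∘ₗ S)) z :=
  LinearMap.congr_fun (f := sandwich act g x ∘ₗ S.lTensor A)
    (g := TensorProduct.lift (act.compl₂ (g ∘ₗ act.flip x ∘ₗ S)))
    (TensorProduct.ext' fun _ _ => rfl) z

theorem sandwich_lTensor_comm (g : Module.End ℂ V) (x : V) (S : A →ₗ[ℂ] A) (z : A ⊗[ℂ] A) :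
    sandwich act g x (S.lTensor A (TensorProduct.comm ℂ A A z)) =
      TensorProduct.lift (act.compl₂ (g ∘ₗ act.flip x ∘ₗ S)).flip z :=
  LinearMap.congr_fun (f := sandwich act g x ∘ₗ S.lTensor A ∘ₗ
    (TensorProduct.comm ℂ A A).toLinearMap)
    (g := TensorProduct.lift (act.compl₂ (g ∘ₗ act.flip x ∘ₗ S)).flip)
    (TensorProduct.ext' fun _ _ => rfl) z

theorem sandwich_id [IsScalarTower ℂ A A] [SMulCommClass ℂ A A] (ha : IsLeftAction act) (x : V)
    (z : A ⊗[ℂ] A) : sandwich act .id x z = act (LinearMap.mul' ℂ A z) x :=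
  LinearMap.congr_fun (g := act.flip x ∘ₗ LinearMap.mul' ℂ A)
    (TensorProduct.ext' fun p q => (ha p q x).symm) z

theorem exists_adjointAction [IsScalarTower ℂ A A] [SMulCommClass ℂ A A] (ha : IsLeftAction act)
    (hu : IsUnitalAction act) (hn : IsNondegenerateAction act)
    {Q T : Module.End ℂ (A ⊗[ℂ] A)} {S : A →ₗ[ℂ] A}
    (hQ : ∀ a b c, mulLeft₁ c (Q (a ⊗ₜ b)) =
      (LinearMap.mulRight ℂ b ∘ₗ S).lTensor A (T (c ⊗ₜ a))) :
    ∃ L : A →ₗ[ℂ] Module.End ℂ V →ₗ[ℂ] Module.End ℂ V,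
      ∀ a g c x, L a g (act c x) = sandwich act g x (Q (a ⊗ₜ c)) := by
  let F : A →ₗ[ℂ] Module.End ℂ V →ₗ[ℂ] A ⊗[ℂ] V →ₗ[ℂ] V :=
    LinearMap.mk₂ ℂ
      (fun a g => TensorProduct.lift ((sandwich act g).flip ∘ₗ Q ∘ₗ TensorProduct.mk ℂ A A a))
      (fun _ _ _ => by ext; simp) (fun _ _ _ => by ext; simp)
      (fun _ _ _ => by ext; simp) (fun _ _ _ => by ext; simp)
  have hact (a : A) (g : Module.End ℂ V) (b : A) (z : A ⊗[ℂ] V) : act b (F a g z) =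
      sandwich act g (TensorProduct.lift act z) (S.lTensor A (T (b ⊗ₜ a))) := by
    refine LinearMap.congr_fun (?_ : act b ∘ₗ F a g =
      (sandwich act g).flip (S.lTensor A (T (b ⊗ₜ a))) ∘ₗ TensorProduct.lift act) z
    ext c x
    exact (act_sandwich ha g x b (Q (a ⊗ₜ c))).trans
      (by rw [hQ, sandwich_lTensor_mulRight ha]; rfl)
  have hF (a : A) (g : Module.End ℂ V) (z : A ⊗[ℂ] V) (hz : TensorProduct.lift act z = 0) :
      F a g z = 0 :=
    hn _ fun b => by rw [hact, hz, map_zero, LinearMap.zero_apply]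
  exact ⟨F.compr₂ (LinearMap.lcomp ℂ V hu.split), fun a g => hu.map_split_act (hF a g)⟩

end Sandwich

/-! ### Invariant products on modules -/

section InvariantProducts

variable {A V : Type*} [NonUnitalRing A] [Module ℂ A] [IsScalarTower ℂ A A] [SMulCommClass ℂ A A]
  [AddCommGroup V] [Module ℂ V] {act : A →ₗ[ℂ] V →ₗ[ℂ] V}

variable (act) in
/-- The bilinear map `π` on a module satisfies `a π(x, y) = ∑ π(a₍₁₎x, a₍₂₎y)`; on a unital module
the elements `bx` and `cy` suffice. -/
def IsInvariantProduct (H : WeakMultiplierHopfAlgebra A) (π : V →ₗ[ℂ] V →ₗ[ℂ] V) : Prop :=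
  ∀ (a b c : A) (x y : V), act a (π (act b x) (act c y)) =
    TensorProduct.lift π (TensorProduct.map (act.flip x) (act.flip y) ((H.Δ a).l (b ⊗ₜ c)))

namespace IsInvariantProduct

variable {H : WeakMultiplierHopfAlgebra A} {π : V →ₗ[ℂ] V →ₗ[ℂ] V}
  (hπ : IsInvariantProduct act H π)
include hπ

theorem act_lift_map (a : A) (x y : V) (z : A ⊗[ℂ] A) :
    act a (TensorProduct.lift π (TensorProduct.map (act.flip x) (act.flip y) z)) =
      TensorProduct.lift π (TensorProduct.map (act.flip x) (act.flip y) ((H.Δ a).l z)) := by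
  refine LinearMap.congr_fun (f := act a ∘ₗ TensorProduct.lift π ∘ₗ
    TensorProduct.map (act.flip x) (act.flip y)) (g := TensorProduct.lift π ∘ₗ
      TensorProduct.map (act.flip x) (act.flip y) ∘ₗ (H.Δ a).l) ?_ z
  exact TensorProduct.ext' fun b c => hπ a b c x y

theorem lift_map_E_l (hn : IsNondegenerateAction act) (x y : V) (z : A ⊗[ℂ] A) :
    TensorProduct.lift π (TensorProduct.map (act.flip x) (act.flip y) (H.E.l z)) =
      TensorProduct.lift π (TensorProduct.map (act.flip x) (act.flip y) z) := by
  rw [← sub_eq_zero]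
  exact hn _ fun a => by rw [map_sub, hπ.act_lift_map, hπ.act_lift_map, H.Δ_l_E_l, sub_self]

theorem sandwich_act (d : A) (v y : V) (z : A ⊗[ℂ] A) :
    sandwich act (π (act d v)) y z = TensorProduct.lift π
      (TensorProduct.map (act.flip v) (act.flip y) (mulRight₁ d (H.T₁ z))) := by
  refine LinearMap.congr_fun (g := TensorProduct.lift π ∘ₗ
    TensorProduct.map (act.flip v) (act.flip y) ∘ₗ mulRight₁ d ∘ₗ H.T₁)
    (TensorProduct.ext' fun p q => ?_) z
  simp only [LinearMap.comp_apply]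
  rw [← H.Δ_l_tmul, ← hπ, sandwich_tmul]

variable (hu : IsUnitalAction act) {R₁ : Module.End ℂ (A ⊗[ℂ] A)}
  (hR₁ : IsGenInv H.T₁ H.E.l H.G₁ R₁)
include hu hR₁

theorem sandwich_G₁ (w y : V) (z : A ⊗[ℂ] A) :
    sandwich act (π w) y (H.G₁ z) = sandwich act (π w) y z := by
  refine LinearMap.congr_fun (f := ((sandwich act).flip y ∘ₗ π).flip (H.G₁ z))
    (g := ((sandwich act).flip y ∘ₗ π).flip z) (hu.hom_ext fun d v => ?_) w
  simp only [LinearMap.flip_apply, LinearMap.comp_apply]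
  rw [hπ.sandwich_act, hπ.sandwich_act, ← hR₁.apply_left, hR₁.apply_right, H.E_l_T₁]

/-- `π(aw, cy) = ∑ a₍₁₎π(w, S(a₍₂₎)cy)`. -/
theorem apply_act (ha : IsLeftAction act) (hn : IsNondegenerateAction act) (a c : A) (w y : V) :
    π (act a w) (act c y) = sandwich act (π w) y (R₁ (a ⊗ₜ c)) := by
  refine LinearMap.congr_fun (f := (π ∘ₗ act a).flip (act c y))
    (g := ((sandwich act).flip y ∘ₗ π).flip (R₁ (a ⊗ₜ c))) (hu.hom_ext fun d v => ?_) w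
  simp only [LinearMap.flip_apply, LinearMap.comp_apply]
  rw [hπ.sandwich_act, hR₁.apply_right, ← l_mulRight₁ H.nondegenerate₂, hπ.lift_map_E_l hn,
    LinearMap.rTensor_tmul, LinearMap.mulRight_apply, TensorProduct.map_tmul,
    TensorProduct.lift.tmul, LinearMap.flip_apply, LinearMap.flip_apply, ha]

end IsInvariantProduct

end InvariantProducts

/-! ### The action on the multipliers of a module algebra -/

section DoubleSandwich

variable {A R : Type*} [NonUnitalRing A] [Module ℂ A]
  [NonUnitalRing R] [Module ℂ R] [IsScalarTower ℂ R R] [SMulCommClass ℂ R R]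
  {act : A →ₗ[ℂ] R →ₗ[ℂ] R}

variable (act) in
/-- `q' ⊗ (p ⊗ q) ↦ p(((q'z)m)(qx))`, the common form of the two products that have to agree for the
adjoint actions on the left and right parts of `m` to form a multiplier. -/
def doubleSandwich (m : MultAlg R) (z x : R) : A ⊗[ℂ] (A ⊗[ℂ] A) →ₗ[ℂ] R :=
  TensorProduct.lift act ∘ₗ
    (LinearMap.mul' ℂ R ∘ₗ TensorProduct.map (m.r ∘ₗ act.flip z) (act.flip x)).lTensor A ∘ₗ
      (TensorProduct.leftComm ℂ A A A).toLinearMap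

theorem doubleSandwich_tmul (m : MultAlg R) (z x : R) (q : A) (w : A ⊗[ℂ] A) :
    doubleSandwich act m z x (q ⊗ₜ w) =
      sandwich act (LinearMap.mul ℂ R (m.r (act q z))) x w :=
  LinearMap.congr_fun (f := doubleSandwich act m z x ∘ₗ TensorProduct.mk ℂ A _ q)
    (TensorProduct.ext' fun _ _ => by simp [doubleSandwich]) w

theorem doubleSandwich_assoc_comm (m : MultAlg R) (z x : R) (q : A) (u : A ⊗[ℂ] A) :
    doubleSandwich act m z x (TensorProduct.assoc ℂ A A A (TensorProduct.comm ℂ A A u ⊗ₜ q)) =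
      sandwich act ((LinearMap.mul ℂ R).flip (m.l (act q x))) z u :=
  LinearMap.congr_fun (f := doubleSandwich act m z x ∘ₗ
    (TensorProduct.assoc ℂ A A A).toLinearMap ∘ₗ (TensorProduct.mk ℂ _ A).flip q ∘ₗ
      (TensorProduct.comm ℂ A A).toLinearMap)
    (TensorProduct.ext' fun _ _ => by simp [doubleSandwich, r_mul_eq]) u

end DoubleSandwich

section ModuleAlgebra

open WeakMultiplierHopfAlgebra

variable {A R : Type*} [NonUnitalRing A] [Module ℂ A] [IsScalarTower ℂ A A] [SMulCommClass ℂ A A]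
  [NonUnitalRing R] [Module ℂ R] [IsScalarTower ℂ R R] [SMulCommClass ℂ R R]
  {act : A →ₗ[ℂ] R →ₗ[ℂ] R}

namespace IsModuleAlgebra

variable {H K : WeakMultiplierHopfAlgebra A} {R₁ R₁' : Module.End ℂ (A ⊗[ℂ] A)}
  (hR : IsModuleAlgebra H act)
include hR

theorem isInvariantProduct_mul : IsInvariantProduct act H (LinearMap.mul ℂ R) := hR.act_mul

theorem isInvariantProduct_flip_mul (h : IsCop H K) :
    IsInvariantProduct act K (LinearMap.mul ℂ R).flip := by
  intro a b c x y
  rw [h a, swap_l, flipConj_tmul]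
  exact (hR.act_mul a c b y x).trans (LinearMap.congr_fun (f := LinearMap.mul' ℂ R ∘ₗ
    TensorProduct.map (act.flip y) (act.flip x))
    (g := TensorProduct.lift (LinearMap.mul ℂ R).flip ∘ₗ
      TensorProduct.map (act.flip x) (act.flip y) ∘ₗ (TensorProduct.comm ℂ A A).toLinearMap)
    (TensorProduct.ext' fun _ _ => rfl) _)

theorem isNondegenerateAction (h : IsCop H K) : IsNondegenerateAction act :=
  hR.isUnital.isNondegenerateAction hR.isLeftAction h.mem_leftIdeal

section

variable (h : IsCop H K)
include h

theorem act_mul_act (hR₁ : IsGenInv H.T₁ H.E.l H.G₁ R₁) (a c : A) (w y : R) :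
    act a w * act c y = sandwich act (LinearMap.mul ℂ R w) y (R₁ (a ⊗ₜ c)) :=
  hR.isInvariantProduct_mul.apply_act hR.isUnital hR₁ hR.isLeftAction
    (hR.isNondegenerateAction h) a c w y

theorem act_mul_act' (hR₁' : IsGenInv K.T₁ K.E.l K.G₁ R₁') (a c : A) (w y : R) :
    act c y * act a w = sandwich act ((LinearMap.mul ℂ R).flip w) y (R₁' (a ⊗ₜ c)) :=
  (hR.isInvariantProduct_flip_mul h).apply_act hR.isUnital hR₁' hR.isLeftAction
    (hR.isNondegenerateAction h) a c w y

theorem mul_sandwich (hR₁' : IsGenInv K.T₁ K.E.l K.G₁ R₁') (m : MultAlg R) (e : A) (z x : R)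
    (t : A ⊗[ℂ] A) : act e z * sandwich act m.l x t =
      doubleSandwich act m z x (onLegs₁₂ A (flipConj R₁') (e ⊗ₜ t)) := by
  refine LinearMap.congr_fun (f := LinearMap.mul ℂ R (act e z) ∘ₗ sandwich act m.l x)
    (g := doubleSandwich act m z x ∘ₗ onLegs₁₂ A (flipConj R₁') ∘ₗ TensorProduct.mk ℂ A _ e)
    (TensorProduct.ext' fun p q => ?_) t
  simp only [LinearMap.comp_apply, TensorProduct.mk_apply, onLegs₁₂_tmul, flipConj_tmul,
    doubleSandwich_assoc_comm, ← hR.act_mul_act' h hR₁', sandwich_tmul, LinearMap.mul_apply']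

theorem sandwich_mul (hR₁ : IsGenInv H.T₁ H.E.l H.G₁ R₁) (m : MultAlg R) (d : A) (z x : R)
    (u : A ⊗[ℂ] A) : sandwich act m.r z u * act d x = doubleSandwich act m z x
      (R₁.lTensor A (TensorProduct.assoc ℂ A A A (TensorProduct.comm ℂ A A u ⊗ₜ d))) := by
  refine LinearMap.congr_fun (f := (LinearMap.mul ℂ R).flip (act d x) ∘ₗ sandwich act m.r z)
    (g := doubleSandwich act m z x ∘ₗ R₁.lTensor A ∘ₗ (TensorProduct.assoc ℂ A A A).toLinearMap ∘ₗ
      (TensorProduct.mk ℂ _ A).flip d ∘ₗ (TensorProduct.comm ℂ A A).toLinearMap)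
    (TensorProduct.ext' fun p q => ?_) u
  simpa [doubleSandwich_tmul] using hR.act_mul_act h hR₁ p d (m.r (act q z)) x

theorem sandwich_l_G₁ (hR₁ : IsGenInv H.T₁ H.E.l H.G₁ R₁)
    (hR₁' : IsGenInv K.T₁ K.E.l K.G₁ R₁') (hcomm : LegComm (flipConj R₁') H.G₁)
    (m : MultAlg R) (x : R) (t : A ⊗[ℂ] A) :
    sandwich act m.l x (H.G₁ t) = sandwich act m.l x t := by
  have hdouble (z : R) (w : A ⊗[ℂ] (A ⊗[ℂ] A)) :
      doubleSandwich act m z x (H.G₁.lTensor A w) = doubleSandwich act m z x w := by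
    refine LinearMap.congr_fun (f := doubleSandwich act m z x ∘ₗ H.G₁.lTensor A)
      (TensorProduct.ext' fun q u => ?_) w
    rw [LinearMap.comp_apply, LinearMap.lTensor_tmul, doubleSandwich_tmul, doubleSandwich_tmul,
      hR.isInvariantProduct_mul.sandwich_G₁ hR.isUnital hR₁]
  refine hR.nondegenerate.eq_of_mul_left fun z => ?_
  refine LinearMap.congr_fun (f := LinearMap.mulRight ℂ (sandwich act m.l x (H.G₁ t)))
    (g := LinearMap.mulRight ℂ (sandwich act m.l x t)) (hR.isUnital.hom_ext fun e z => ?_) z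
  rw [LinearMap.mulRight_apply, LinearMap.mulRight_apply, hR.mul_sandwich h hR₁',
    hR.mul_sandwich h hR₁', ← LinearMap.lTensor_tmul, hcomm.apply, hdouble]

end

end IsModuleAlgebra

variable {H K : WeakMultiplierHopfAlgebra A} {R₁ R₁' : Module.End ℂ (A ⊗[ℂ] A)} {S : A ≃ₗ[ℂ] A}

/-- The adjoint action of `A` on `M(R)` is `(am)r = ∑ a₍₁₎(m(S(a₍₂₎)r))` and
`r(am) = ∑ a₍₂₎((S⁻¹(a₍₁₎)r)m)`, here for `r = cx`, where the generalized inverses `R₁`, `R₁'` of an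
antipode pair give a meaning to the two sums. -/
structure IsAdjointAction (act : A →ₗ[ℂ] R →ₗ[ℂ] R) (R₁ R₁' : Module.End ℂ (A ⊗[ℂ] A))
    (ext : A →ₗ[ℂ] MultAlg R →ₗ[ℂ] MultAlg R) : Prop where
  l_act : ∀ a m c x, (ext a m).l (act c x) = sandwich act m.l x (R₁ (a ⊗ₜ c))
  r_act : ∀ a m c x, (ext a m).r (act c x) = sandwich act m.r x (R₁' (a ⊗ₜ c))

theorem IsModuleAlgebra.exists_isAdjointAction (hR : IsModuleAlgebra H act)
    (h : IsAntipodePair H K R₁ R₁' S) : ∃ ext, IsAdjointAction act R₁ R₁' ext := by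
  have hn := hR.isNondegenerateAction h.isCop
  obtain ⟨L, hL⟩ := exists_adjointAction hR.isLeftAction hR.isUnital hn h.mulLeft₁_genInv
  obtain ⟨L', hL'⟩ := exists_adjointAction hR.isLeftAction hR.isUnital hn h.symm.mulLeft₁_genInv
  have hcomm : LegComm (flipConj R₁') R₁ :=
    h.symm.legComm_flipConj (h.isCop.legComm_T₂_genInv h.genInv)
  have hcompat (a : A) (m : MultAlg R) (z x : R) : L' a m.r z * x = z * L a m.l x := by
    refine LinearMap.congr_fun₂ (f := LinearMap.mul ℂ R ∘ₗ L' a m.r)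
      (g := (LinearMap.mul ℂ R).compl₂ (L a m.l))
      (hR.isUnital.hom_ext fun e z => hR.isUnital.hom_ext fun d x => ?_) z x
    simp only [LinearMap.comp_apply, LinearMap.compl₂_apply, LinearMap.mul_apply', hL, hL']
    rw [hR.mul_sandwich h.isCop h.genInv_cop, hR.sandwich_mul h.isCop h.genInv,
      ← LinearMap.lTensor_tmul, hcomm.apply, onLegs₁₂_tmul, flipConj_tmul]
  let ext : A ⊗[ℂ] MultAlg R →ₗ[ℂ] MultAlg R := ofCompat hR.nondegenerate
    (TensorProduct.lift (L.compl₂ (lHom R))) (TensorProduct.lift (L'.compl₂ (rHom R)))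
    fun v x y => by
      refine LinearMap.congr_fun (f := LinearMap.mulRight ℂ y ∘ₗ LinearMap.applyₗ x ∘ₗ
        TensorProduct.lift (L'.compl₂ (rHom R))) (g := LinearMap.mulLeft ℂ x ∘ₗ
          LinearMap.applyₗ y ∘ₗ TensorProduct.lift (L.compl₂ (lHom R)))
        (TensorProduct.ext' fun a m => hcompat a m x y) v
  exact ⟨TensorProduct.curry ext, fun a m => hL a m.l, fun a m => hL' a m.r⟩

namespace IsAdjointAction

variable {ext : A →ₗ[ℂ] MultAlg R →ₗ[ℂ] MultAlg R} (hext : IsAdjointAction act R₁ R₁' ext)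
  (hR : IsModuleAlgebra H act) (h : IsAntipodePair H K R₁ R₁' S)
include hext hR h

theorem isLeftAction : IsLeftAction ext := by
  refine fun a b m => ext_of_l hR.nondegenerate (hR.isUnital.hom_ext fun c x => ?_)
  rw [hext.l_act, hext.l_act, h.isCop.genInv_mul_tmul h.genInv]
  refine LinearMap.congr_fun (f := sandwich act m.l x ∘ₗ TensorProduct.lift _)
    (TensorProduct.ext' fun p q => ?_) (R₁ (a ⊗ₜ c))
  rw [sandwich_tmul, hext.l_act, act_sandwich hR.isLeftAction]
  rfl

theorem isNondegenerateAction : IsNondegenerateAction ext := by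
  have hG₁ : LegComm (flipConj R₁') H.G₁ :=
    h.symm.legComm_flipConj (H.legComm_G₁ H.legComm_T₂_T₁)
  refine fun m hm => ext_of_l hR.nondegenerate (hR.isUnital.hom_ext fun c x => ?_)
  have hzero : sandwich act m.l x ∘ₗ R₁ = 0 := TensorProduct.ext' fun a b =>
    (hext.l_act a m b x).symm.trans (by rw [hm]; rfl)
  refine hR.isNondegenerateAction h.isCop _ fun a => ?_
  rw [← sandwich_tmul, ← hR.sandwich_l_G₁ h.isCop h.genInv h.genInv_cop hG₁,
    ← h.genInv.apply_left]
  exact LinearMap.congr_fun hzero _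

theorem apply_incl (a : A) (x : R) : ext a (incl x) = incl (act a x) := by
  refine ext_of_l hR.nondegenerate (hR.isUnital.hom_ext fun c y => ?_)
  rw [hext.l_act]
  exact (hR.act_mul_act h.isCop h.genInv a c x y).symm

theorem apply_one {ρ : MultAlg A →ₐ[ℂ] Module.End ℂ R}
    (hρ : ∀ m c x, ρ m (act c x) = act (m.l c) x) (a : A) (x : R) :
    (ext a 1).l x = ρ (h.targetMap a) x := by
  refine LinearMap.congr_fun (hR.isUnital.hom_ext fun c y => ?_) x
  rw [hext.l_act, hρ, h.targetMap_l, leftSlice_E_l_eq h.genInv, ← sandwich_id hR.isLeftAction]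
  rfl

omit hR

theorem l_act_antipode (a c : A) (m : MultAlg R) (x : R) : (ext a m).l (act (S c) x) =
    TensorProduct.lift (act.compl₂ (m.l ∘ₗ act.flip x ∘ₗ S.toLinearMap))
      (TensorProduct.comm ℂ A A (K.T₂ (c ⊗ₜ a))) := by
  rw [hext.l_act, h.genInv_tmul_antipode, sandwich_lTensor]

theorem r_act_antipode_symm (a c : A) (m : MultAlg R) (x : R) :
    (ext a m).r (act (S.symm c) x) =
      TensorProduct.lift (act.compl₂ (m.r ∘ₗ act.flip x ∘ₗ S.symm.toLinearMap)).flip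
        (H.T₂ (c ⊗ₜ a)) := by
  rw [hext.r_act, h.symm.genInv_tmul_antipode, sandwich_lTensor_comm]

end IsAdjointAction

end ModuleAlgebra

end

theorem mainTheorem7 {A : Type*} [NonUnitalRing A] [Module ℂ A] [IsScalarTower ℂ A A]
    [SMulCommClass ℂ A A] (H : RegularWeakMultiplierHopfAlgebra A)
    {R : Type*} [NonUnitalRing R] [Module ℂ R] [IsScalarTower ℂ R R] [SMulCommClass ℂ R R]
    (act : A →ₗ[ℂ] R →ₗ[ℂ] R) (hR : IsModuleAlgebra H.toWeakMultiplierHopfAlgebra act) :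
    ∃ (S : A ≃ₗ[ℂ] A) (εt : A →ₗ[ℂ] MultAlg A) (ρ : MultAlg A →ₐ[ℂ] Module.End ℂ R)
      (ext : A →ₗ[ℂ] MultAlg R →ₗ[ℂ] MultAlg R),
      H.IsAntipode S ∧ H.IsTargetMap εt ∧ IsMultiplierExtension act ρ ∧
      -- `M(R)` is a non-degenerate left `A`-module, and its action extends the one on `R`
      IsLeftAction ext ∧ IsNondegenerateAction ext ∧
      (∀ a x, ext a (MultAlg.incl x) = MultAlg.incl (act a x)) ∧
      -- `(am)r = ∑ a₍₁₎(m(S(a₍₂₎)r))` for `r = S(c)x`, where `S(a₍₂₎)S(c) = S(c a₍₂₎)`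
      (∀ (a c : A) (m : MultAlg R) (x : R),
        (ext a m).l (act (S c) x) =
          TensorProduct.lift (act.compl₂ (m.l ∘ₗ act.flip x ∘ₗ S.toLinearMap)) (H.T₃ (a ⊗ₜ c))) ∧
      -- `r(am) = ∑ a₍₂₎((S⁻¹(a₍₁₎)r)m)` for `r = S⁻¹(c)x`, where `S⁻¹(a₍₁₎)S⁻¹(c) = S⁻¹(c a₍₁₎)`
      (∀ (a c : A) (m : MultAlg R) (x : R),
        (ext a m).r (act (S.symm c) x) =
          TensorProduct.lift (act.compl₂ (m.r ∘ₗ act.flip x ∘ₗ S.symm.toLinearMap)).flip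
            (H.T₂ (c ⊗ₜ a))) ∧
      -- `a1 = ε_t(a)`
      (∀ a x, (ext a 1).l x = ρ (εt a) x) := by
  obtain ⟨K, hK⟩ := H.exists_isCop
  obtain ⟨R₁, R₁', S, h⟩ := hK.exists_isAntipodePair
  obtain ⟨ρ, hρ, hρ_act⟩ :=
    exists_isMultiplierExtension hR.isLeftAction hR.isUnital (hR.isNondegenerateAction hK)
  obtain ⟨ext, hext⟩ := hR.exists_isAdjointAction h
  refine ⟨S, h.targetMap, ρ, ext, RegularWeakMultiplierHopfAlgebra.isAntipode h, h.targetMap_l, hρ,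
    hext.isLeftAction hR h, hext.isNondegenerateAction hR h, hext.apply_incl hR h,
    fun a c m x => ?_, hext.r_act_antipode_symm h, hext.apply_one hR h hρ_act⟩
  rw [RegularWeakMultiplierHopfAlgebra.T₃_tmul hK]
  exact hext.l_act_antipode h a c m x
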